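/- Let $\alpha>0$ and $\mathbb R^+=(0,\infty)$. For $f\in L_2(\mathbb R^+)$ (complex valued) put, for a.e. $s>0$, $$\mathcal C_\alpha f(s)=\frac{\alpha}{s^\alpha}\int_0^s (s-u)^{\alpha-1}f(u)\,du,\qquad \mathcal C_\alpha^* f(s)=\alpha\int_s^\infty\frac{(u-s)^{\alpha-1}}{u^\alpha}f(u)\,du .$$ The integrals converge absolutely for a.e. $s>0$, and they define injective bounded linear operators $\mathcal C_\alpha,\mathcal C_\alpha^*$ on $L_2(\mathbb R^+)$. Let $\mathcal T_2^{(\alpha)}(t^\alpha):=\mathcal C_\alpha^*(L_2(\mathbb R^+))$, with inner product $(f|g)_{2,(\alpha)}=\Gamma(\alpha+1)^2\big((\mathcal C_\alpha^*)^{-1}f\,\big|\,(\mathcal C_\alpha^*)^{-1}g\big)_2$, and let $\mathcal T^2_{(\alpha)}:=\mathcal C_\alpha(L_2(\mathbb R^+))$, with inner product $(f|g)_{(\alpha),2}=\Gamma(\alpha+1)^2\big(\mathcal C_\alpha^{-1}f\,\big|\,\mathcal C_\alpha^{-1}g\big)_2$; the corresponding norms are $\Gamma(\alpha+1)\|(\mathcal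 C_\alpha^*)^{-1}f\|_2$ and $\Gamma(\alpha+1)\|\mathcal C_\alpha^{-1}f\|_2$. Then: 1. $\mathcal C_\alpha(L_2(\mathbb R^+))=\mathcal T_2^{(\alpha)}(t^\alpha)$ as subspaces of $L_2(\mathbb R^+)$, with the same inner product and the same norm. 2. The Laplace transform $\mathcal Lf(z)=\int_0^\infty f(t)e^{-zt}\,dt$, $\Re z>0$, is injective on $L_2(\mathbb R^+)$. The Laplace images $\mathcal L(\mathcal T^2_{(\alpha)})$ and $\mathcal L(\mathcal T_2^{(\alpha)}(t^\alpha))$, with the inner products transferred by $\mathcal L$, each have a unique reproducing kernel on $\{\Re z>0\}$, and the two kernels coincide: both are equal to $$K_\alpha(z,w)=\int_0^1\int_0^1\frac{(1-x)^{\alpha-1}}{\Gamma(\alpha)}\,\frac{(1-y)^{\alpha-1}}{\Gamma(\alpha)}\,\frac{dx\,dy}{xz+y\overline w}.$$ 3. A function $f\in L_2(\mathbb R^+)$ belongs to $\mathcal C_\alpha(L_2(\mathbb R^+))$ if and only if $t^\alpha f$ has a Riemann–Liouville derivative $u=\mathcal D^\alpha(t^\alpha f)$, that is, $u\in L_2(\mathbb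 R^+)$ with $x^\alpha f(x)=\int_0^x\frac{(x-y)^{\alpha-1}}{\Gamma(\alpha)}u(y)\,dy$ for a.e. $x>0$. It belongs to $\mathcal T_2^{(\alpha)}(t^\alpha)$ if and only if it has a Weyl derivative $v=W^\alpha f$, that is, $t^\alpha v\in L_2(\mathbb R^+)$ and $f(t)=\int_t^\infty\frac{(s-t)^{\alpha-1}}{\Gamma(\alpha)}v(s)\,ds$ for a.e. $t>0$. These derivatives are unique up to null sets. For every $f$ in the common space, $$\|\mathcal D^\alpha(t^\alpha f)\|_2=\Gamma(\alpha+1)\|\mathcal C_\alpha^{-1}f\|_2=\Gamma(\alpha+1)\|(\mathcal C_\alpha^*)^{-1}f\|_2=\|t^\alpha W^\alpha f\|_2 ;$$ in particular the norms $\|\mathcal D^\alpha(t^\alpha f)\|_2$ and $\|t^\alpha W^\alpha f\|_2$ are equivalent. -/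

import Mathlib

open MeasureTheory

noncomputable section

namespace CesaroHardy

/-- Lebesgue measure on the half-line `(0, ∞)`. -/
abbrev halfLine : Measure ℝ := volume.restrict (Set.Ioi 0)

/-- The complex Hilbert space `L₂(ℝ⁺)`. -/
abbrev L2 : Type := Lp ℂ 2 halfLine

/-- `𝒞_α f (s) = (α / s ^ α) ∫₀ˢ (s - u) ^ (α - 1) f(u) du`, for `s > 0`. -/
def cesaroFun (α : ℝ) (f : ℝ → ℂ) (s : ℝ) : ℂ :=
  (α / s ^ α) • ∫ u in Set.Ioo 0 s, (s - u) ^ (α - 1) • f u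

/-- `𝒞*_α f (s) = α ∫ₛ^∞ ((u - s) ^ (α - 1) / u ^ α) f(u) du`, for `s > 0`. -/
def cesaroStarFun (α : ℝ) (f : ℝ → ℂ) (s : ℝ) : ℂ :=
  α • ∫ u in Set.Ioi s, ((u - s) ^ (α - 1) / u ^ α) • f u

open Classical in
/-- The operator `𝒞_α` on `L₂(ℝ⁺)`. The theorem asserts that the condition always holds. -/
def cesaro (α : ℝ) (f : L2) : L2 :=
  if h : MemLp (cesaroFun α f) 2 halfLine then h.toLp (cesaroFun α f) else 0

open Classical in
/-- The operator `𝒞*_α` on `L₂(ℝ⁺)`. The theorem asserts that the condition always holds. -/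
def cesaroStar (α : ℝ) (f : L2) : L2 :=
  if h : MemLp (cesaroStarFun α f) 2 halfLine then h.toLp (cesaroStarFun α f) else 0

/-- The space `𝒯₂^(α)(t^α) = 𝒞*_α(L₂(ℝ⁺))`. -/
def lebesgueSobolev (α : ℝ) : Set L2 := Set.range (cesaroStar α)

/-- The space `𝒞_α(L₂(ℝ⁺))`. -/
def cesaroRange (α : ℝ) : Set L2 := Set.range (cesaro α)

/-- The inner product `(f | g) = Γ(α + 1)² ∫₀^∞ (T⁻¹ f)(s) conj ((T⁻¹ g)(s)) ds` transferred to
the range of an injective operator `T` of `L₂(ℝ⁺)`; linear in `f`. -/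
def rangeInner (α : ℝ) (T : L2 → L2) (f g : L2) : ℂ :=
  (Real.Gamma (α + 1) : ℂ) ^ 2 *
    ∫ s in Set.Ioi (0 : ℝ),
      (Function.invFun T f : L2) s * (starRingEnd ℂ) ((Function.invFun T g : L2) s)

/-- The norm `Γ(α + 1) ‖T⁻¹ f‖₂` transferred to the range of an injective operator `T`. -/
def rangeNorm (α : ℝ) (T : L2 → L2) (f : L2) : ℝ :=
  Real.Gamma (α + 1) * ‖Function.invFun T f‖

/-- The open right half-plane `ℂ⁺`. -/
abbrev HalfPlane : Type := {z : ℂ // 0 < z.re}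

/-- The Laplace transform `ℒ f (z) = ∫₀^∞ f(t) e^{-zt} dt` of `f ∈ L₂(ℝ⁺)`, for `z ∈ ℂ⁺`. -/
def laplace (f : L2) (z : HalfPlane) : ℂ :=
  ∫ t in Set.Ioi (0 : ℝ), f t * Complex.exp (-(z : ℂ) * (t : ℂ))

/-- The Laplace image of the range of `T`. -/
def laplaceImage (T : L2 → L2) : Set (HalfPlane → ℂ) := laplace '' Set.range T

/-- The inner product `(ℒ f | ℒ g) = (f | g)` on the Laplace image of the range of `T`. -/
def laplaceInner (α : ℝ) (T : L2 → L2) (F G : HalfPlane → ℂ) : ℂ :=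
  rangeInner α T (Function.invFun laplace F) (Function.invFun laplace G)

/-- `K` is a reproducing kernel of the space `S` of functions on `X` with inner product `ip`
(linear in the first variable). -/
structure IsReproducingKernel {X : Type*} (S : Set (X → ℂ)) (ip : (X → ℂ) → (X → ℂ) → ℂ)
    (K : X → X → ℂ) : Prop where
  mem : ∀ w, (fun z => K z w) ∈ S
  reproducing : ∀ w, ∀ F ∈ S, ip F (fun z => K z w) = F w

/-- The kernel `K_α(z, w) =
∫₀¹ ∫₀¹ ((1 - x)^(α - 1) / Γ(α)) ((1 - y)^(α - 1) / Γ(α)) / (x z + y conj w) dx dy`. -/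
def kernelK (α : ℝ) (z w : HalfPlane) : ℂ :=
  ∫ x in (0 : ℝ)..1, ∫ y in (0 : ℝ)..1,
    (((1 - x) ^ (α - 1) / Real.Gamma α * ((1 - y) ^ (α - 1) / Real.Gamma α) : ℝ) : ℂ) /
      ((x : ℂ) * (z : ℂ) + (y : ℂ) * (starRingEnd ℂ) (w : ℂ))

/-- `u = 𝒟^α φ` is the Riemann-Liouville fractional derivative of `φ`: `u ∈ L₂(ℝ⁺)` and
`φ(x) = ∫₀ˣ ((x - y) ^ (α - 1) / Γ(α)) u(y) dy` for almost every `x > 0`. -/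
def IsRLDeriv (α : ℝ) (φ u : ℝ → ℂ) : Prop :=
  MemLp u 2 halfLine ∧
    ∀ᵐ x ∂halfLine, φ x = ∫ y in Set.Ioo 0 x, ((x - y) ^ (α - 1) / Real.Gamma α) • u y

/-- `v = W^α f` is the Weyl fractional derivative of `f`: `t ^ α v ∈ L₂(ℝ⁺)` and
`f(t) = ∫ₜ^∞ ((s - t) ^ (α - 1) / Γ(α)) v(s) ds` for almost every `t > 0`. -/
def IsWeylDeriv (α : ℝ) (f v : ℝ → ℂ) : Prop :=
  MemLp (fun t => t ^ α • v t) 2 halfLine ∧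
    ∀ᵐ t ∂halfLine, f t = ∫ s in Set.Ioi t, ((s - t) ^ (α - 1) / Real.Gamma α) • v s

end CesaroHardy

end

open CesaroHardy

/-! The heart of the matter is that `𝒞_α` is a normal operator. Its kernel is homogeneous of degree
`-1`, and the substitution `s ↦ u v / s` turns `∫ K(s,u) K(s,v) ds` into `∫ K(u,s) K(v,s) ds`
(`integral_cesaroKernel_mul_comm`), so `𝒞*𝒞 = 𝒞𝒞*`. Boundedness comes from the Schur test with
weight `u ^ (-1/2)`. For an injective normal operator `𝒞* = 𝒞 V` with `V` unitary
(`exists_linearIsometryEquiv_of_normal`): the ranges agree, and so do the transferred inner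
products.

Injectivity rests on the Laplace transform. Since `𝒞*` sends `t ^ α e^{-λt}` to a multiple of
`e^{-λt}`, `𝒞 f = 0` makes `ℒ f` vanish at all positive integers, and Weierstrass approximation
gives `f = 0`.

Evaluation of `ℒ` at `w` is pairing with an exponential `e_w`. The kernel of the image of the range
of `A` is therefore `⟪A* e_z, A* e_w⟫ / Γ(α+1)²`; by normality it is the same for `𝒞` and `𝒞*`, and
Fubini computes it. Finally, `𝒟^α(t^α f)` and `t^α W^α f` are `Γ(α+1)` times the preimages of `f`
under `𝒞` and `𝒞*`. -/

open CesaroHardy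

/-! ### Injective normal operators -/

section Normal

open scoped InnerProductSpace

variable {H : Type*} [NormedAddCommGroup H] [InnerProductSpace ℂ H] [CompleteSpace H]

/-- An injective normal operator and its adjoint differ by a unitary operator on the right. -/
theorem exists_linearIsometryEquiv_of_normal {A B : H →L[ℂ] H}
    (hadj : ∀ x y, ⟪A x, y⟫_ℂ = ⟪x, B y⟫_ℂ) (hn : ∀ x y, ⟪A x, A y⟫_ℂ = ⟪B x, B y⟫_ℂ)
    (hA : Function.Injective A) : ∃ V : H ≃ₗᵢ[ℂ] H, ∀ x, B x = A (V x) := by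
  have hnorm : ∀ x, ‖A x‖ = ‖B x‖ := fun x => by
    rw [@norm_eq_sqrt_re_inner ℂ, @norm_eq_sqrt_re_inner ℂ _ _ _ _ (B x), hn]
  have hB : Function.Injective B := (injective_iff_map_eq_zero B).2 fun x hx =>
    (injective_iff_map_eq_zero A).1 hA x (by rw [← norm_eq_zero, hnorm, hx, norm_zero])
  have hadj' : ∀ x y, ⟪B x, y⟫_ℂ = ⟪x, A y⟫_ℂ := fun x y => by
    rw [← inner_conj_symm, ← hadj, inner_conj_symm]
  have hcomm : ∀ x, A (B x) = B (A x) := fun x => ext_inner_left ℂ fun y => by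
    rw [← hadj, ← hadj', hn]
  -- The orthogonal complement of the range is the kernel of the adjoint.
  have dense : ∀ {S T : H →L[ℂ] H}, (∀ x y, ⟪S x, y⟫_ℂ = ⟪x, T y⟫_ℂ) → Function.Injective T →
      DenseRange S := fun {S T} h hT => by
    have : (LinearMap.range (S : H →ₗ[ℂ] H)).topologicalClosure = ⊤ := by
      rw [Submodule.topologicalClosure_eq_top_iff, Submodule.eq_bot_iff]
      intro y hy
      refine (injective_iff_map_eq_zero T).1 hT y (ext_inner_left ℂ fun x => ?_)
      rw [← h, inner_zero_right]
      exact (Submodule.mem_orthogonal _ _).1 hy _ ⟨x, rfl⟩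
    have h2 := Submodule.dense_iff_topologicalClosure_eq_top.2 this
    exact h2
  have dA : DenseRange A := dense hadj hB
  have dB : DenseRange B := dense hadj' hA
  -- `A x ↦ B x` is isometric between dense subspaces because `‖A x‖ = ‖B x‖`; `V` is its continuous
  -- extension and `W` that of the inverse.
  let V : H →L[ℂ] H := (B : H →ₗ[ℂ] H).extendOfNorm (A : H →ₗ[ℂ] H)
  let W : H →L[ℂ] H := (A : H →ₗ[ℂ] H).extendOfNorm (B : H →ₗ[ℂ] H)
  have hV : ∀ x, V (A x) = B x := LinearMap.extendOfNorm_eq dA ⟨1, fun x => by simp [hnorm]⟩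
  have hW : ∀ x, W (B x) = A x := LinearMap.extendOfNorm_eq dB ⟨1, fun x => by simp [hnorm]⟩
  have hWV : ∀ x, W (V x) = x := congrFun <|
    dA.equalizer (by fun_prop) continuous_id (funext fun x => by simp [hV, hW])
  have hVW : ∀ x, V (W x) = x := congrFun <|
    dB.equalizer (by fun_prop) continuous_id (funext fun x => by simp [hV, hW])
  have hiso : ∀ x, ‖V x‖ = ‖x‖ := congrFun <|
    dA.equalizer (by fun_prop) (by fun_prop) (funext fun x => by simp [hV, hnorm])
  refine ⟨⟨LinearEquiv.ofLinearMap V.toLinearMap W.toLinearMap (LinearMap.ext hVW) (LinearMap.ext hWV), hiso⟩, ?_⟩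
  -- On the dense range of `A`: `A (V (A x)) = A (B x) = B (A x)`.
  exact congrFun <| DenseRange.equalizer (f := A) (g := B) (h := fun x => A (V x)) dA (by fun_prop)
    (by fun_prop)
    (funext fun x => by simp [hV, hcomm])

end Normal

/-! ### The Schur test -/

section Schur

open scoped ENNReal

variable {X : Type*} [MeasurableSpace X] {μ : Measure X}

/-- The Cauchy-Schwarz inequality for a nonnegative kernel with a positive weight. -/
theorem sq_lintegral_mul_le_weight {k f p : X → ℝ≥0∞} (hk : Measurable k) (hf : Measurable f)
    (hp : Measurable p) (hp0 : ∀ᵐ x ∂μ, p x ≠ 0) (hpt : ∀ᵐ x ∂μ, p x ≠ ⊤) :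
    (∫⁻ u, k u * f u ∂μ) ^ 2 ≤ (∫⁻ u, k u * p u ∂μ) * ∫⁻ u, k u * ((p u)⁻¹ * f u ^ 2) ∂μ := by
  -- The splitting is `k f = (k p)^{1/2} (k p⁻¹ f²)^{1/2}`.
  have h := ENNReal.lintegral_mul_le_Lp_mul_Lq μ Real.HolderConjugate.two_two
    (f := fun u => (k u * p u) ^ (1 / 2 : ℝ)) (g := fun u => (k u * ((p u)⁻¹ * f u ^ 2)) ^ (1 / 2 : ℝ))
    (by fun_prop) (by fun_prop)
  have e : ∀ a : ℝ≥0∞, (a ^ (1 / 2 : ℝ)) ^ (2 : ℝ) = a := fun a => by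
    rw [← ENNReal.rpow_mul]; norm_num
  have e' : ∀ a : ℝ≥0∞, (a ^ (2 : ℕ)) ^ (1 / 2 : ℝ) = a := fun a => by
    rw [← ENNReal.rpow_natCast, ← ENNReal.rpow_mul]; norm_num
  have e'' : ∀ a : ℝ≥0∞, (a ^ (1 / 2 : ℝ)) ^ (2 : ℕ) = a := fun a => by
    rw [← ENNReal.rpow_natCast, ← ENNReal.rpow_mul]; norm_num
  simp only [e, Pi.mul_apply] at h
  have h1 : ∫⁻ u, k u * f u ∂μ = ∫⁻ u, (k u * p u) ^ (1 / 2 : ℝ) *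
      (k u * ((p u)⁻¹ * f u ^ 2)) ^ (1 / 2 : ℝ) ∂μ := by
    refine lintegral_congr_ae ?_
    filter_upwards [hp0, hpt] with u h0 ht
    rw [← ENNReal.mul_rpow_of_nonneg _ _ (by norm_num)]
    have : k u * p u * (k u * ((p u)⁻¹ * f u ^ 2)) = (k u * f u) ^ 2 := by
      calc _ = (k u * f u) ^ 2 * (p u * (p u)⁻¹) := by ring
        _ = _ := by rw [ENNReal.mul_inv_cancel h0 ht, mul_one]
    rw [this, e']
  rw [h1]
  refine (pow_le_pow_left' h 2).trans_eq ?_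
  rw [mul_pow, e'', e'']

/-- The **Schur test** with a weight `p`. -/
theorem lintegral_sq_lintegral_mul_le [SFinite μ] {K : X → X → ℝ≥0∞} {f p : X → ℝ≥0∞} {M : ℝ≥0∞}
    (hK : Measurable (Function.uncurry K)) (hf : Measurable f)
    (hp : Measurable p) (hp0 : ∀ᵐ x ∂μ, p x ≠ 0) (hpt : ∀ᵐ x ∂μ, p x ≠ ⊤)
    (h₁ : ∀ᵐ s ∂μ, ∫⁻ u, K s u * p u ∂μ ≤ M * p s)
    (h₂ : ∀ᵐ u ∂μ, ∫⁻ s, K s u * p s ∂μ ≤ M * p u) :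
    ∫⁻ s, (∫⁻ u, K s u * f u ∂μ) ^ 2 ∂μ ≤ M ^ 2 * ∫⁻ u, f u ^ 2 ∂μ := by
  have hK1 : ∀ s, Measurable (K s) := fun s => hK.of_uncurry_left
  have hK2 : ∀ u, Measurable (fun s => K s u) := fun u => hK.of_uncurry_right
  have hm : Measurable (fun q : X × X => M * p q.1 * (K q.1 q.2 * ((p q.2)⁻¹ * f q.2 ^ 2))) := by
    have : Measurable (fun q : X × X => K q.1 q.2) := hK
    fun_prop
  -- `h₁` bounds the first Cauchy-Schwarz factor by `M p(s)`; after Tonelli, `h₂` produces `M p(u)`,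
  -- which cancels `p(u)⁻¹`.
  calc ∫⁻ s, (∫⁻ u, K s u * f u ∂μ) ^ 2 ∂μ
      ≤ ∫⁻ s, ∫⁻ u, M * p s * (K s u * ((p u)⁻¹ * f u ^ 2)) ∂μ ∂μ := by
        refine lintegral_mono_ae ?_
        filter_upwards [h₁] with s hs
        refine (sq_lintegral_mul_le_weight (hK1 s) hf hp hp0 hpt).trans ?_
        rw [lintegral_const_mul _ (by have := hK1 s; fun_prop)]
        gcongr
    _ = ∫⁻ u, ∫⁻ s, M * p s * (K s u * ((p u)⁻¹ * f u ^ 2)) ∂μ ∂μ :=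
        lintegral_lintegral_swap hm.aemeasurable
    _ ≤ ∫⁻ u, M ^ 2 * f u ^ 2 ∂μ := by
        refine lintegral_mono_ae ?_
        filter_upwards [h₂, hp0, hpt] with u hu h0 ht
        calc ∫⁻ s, M * p s * (K s u * ((p u)⁻¹ * f u ^ 2)) ∂μ
            = ∫⁻ s, (M * ((p u)⁻¹ * f u ^ 2)) * (K s u * p s) ∂μ := by
              congr 1; ext s; ring
          _ = (M * ((p u)⁻¹ * f u ^ 2)) * ∫⁻ s, K s u * p s ∂μ :=
              lintegral_const_mul _ (by have := hK2 u; fun_prop)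
          _ ≤ (M * ((p u)⁻¹ * f u ^ 2)) * (M * p u) := by gcongr
          _ = M ^ 2 * f u ^ 2 * ((p u) * (p u)⁻¹) := by ring
          _ = _ := by rw [ENNReal.mul_inv_cancel h0 ht, mul_one]
    _ = _ := lintegral_const_mul _ (by fun_prop)

end Schur

/-! ### Fubini for products of parametric integrals -/

section Fubini

open scoped ENNReal

variable {X Y Z : Type*} [MeasurableSpace X] [MeasurableSpace Y] [MeasurableSpace Z]
  {μ : Measure X} {ν : Measure Y} {ρ : Measure Z} [SFinite μ] [SFinite ν] [SFinite ρ]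

/-- Fubini's theorem for the integral of a product of two parametric integrals. -/
theorem integral_integral_mul_integral {F : X → Y → ℂ} {G : X → Z → ℂ}
    (hF : StronglyMeasurable (Function.uncurry F)) (hG : StronglyMeasurable (Function.uncurry G))
    (h : ∫⁻ s, (∫⁻ x, ‖F s x‖ₑ ∂ν) * (∫⁻ y, ‖G s y‖ₑ ∂ρ) ∂μ ≠ ⊤) :
    ∫ s, (∫ x, F s x ∂ν) * (∫ y, G s y ∂ρ) ∂μ =
      ∫ x, ∫ y, ∫ s, F s x * G s y ∂μ ∂ρ ∂ν := by
  have hF1 : ∀ s, StronglyMeasurable (F s) := fun s => hF.of_uncurry_left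
  have hG1 : ∀ s, StronglyMeasurable (G s) := fun s => hG.of_uncurry_left
  have hFm : StronglyMeasurable (fun q : X × (Y × Z) => F q.1 q.2.1) :=
    hF.comp_measurable (g := fun q : X × (Y × Z) => (q.1, q.2.1)) (by fun_prop)
  have hGm : StronglyMeasurable (fun q : X × (Y × Z) => G q.1 q.2.2) :=
    hG.comp_measurable (g := fun q : X × (Y × Z) => (q.1, q.2.2)) (by fun_prop)
  -- For fixed `s` the integral of `‖F G‖` over `Y × Z` factors, so Tonelli reduces integrability to
  -- `h`.
  have hint : Integrable (fun q : X × (Y × Z) => F q.1 q.2.1 * G q.1 q.2.2) (μ.prod (ν.prod ρ)) := by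
    refine ⟨(hFm.mul hGm).aestronglyMeasurable, ?_⟩
    rw [HasFiniteIntegral, lintegral_prod (fun q : X × (Y × Z) => ‖F q.1 q.2.1 * G q.1 q.2.2‖ₑ)
      (hFm.mul hGm).enorm.aemeasurable]
    refine lt_of_le_of_lt (le_of_eq ?_) h.lt_top
    refine lintegral_congr fun s => ?_
    rw [← lintegral_prod_mul (hF1 s).enorm.aemeasurable (hG1 s).enorm.aemeasurable]
    simp [enorm_mul]
  calc ∫ s, (∫ x, F s x ∂ν) * (∫ y, G s y ∂ρ) ∂μ
      = ∫ s, ∫ q : Y × Z, F s q.1 * G s q.2 ∂(ν.prod ρ) ∂μ := by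
        congr 1; ext s; rw [integral_prod_mul]
    _ = ∫ q : Y × Z, ∫ s, F s q.1 * G s q.2 ∂μ ∂(ν.prod ρ) :=
        integral_integral_swap (f := fun s (q : Y × Z) => F s q.1 * G s q.2) hint
    _ = _ := integral_prod _ hint.integral_prod_right

end Fubini

/-! ### Integral operators on L² with bounded real kernels -/

section Kernel

open scoped ENNReal NNReal InnerProductSpace ComplexConjugate

variable {X : Type*} [MeasurableSpace X] {μ : Measure X}

theorem Complex.enorm_ofReal_eq (r : ℝ) : ‖(r : ℂ)‖ₑ = ‖r‖ₑ := by
  rw [← ofReal_norm, Complex.norm_real, ofReal_norm]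

theorem eLpNorm_two_sq {E : Type*} [NormedAddCommGroup E] (f : X → E) :
    eLpNorm f 2 μ ^ 2 = ∫⁻ x, ‖f x‖ₑ ^ 2 ∂μ := by
  simpa using eLpNorm_nnreal_pow_eq_lintegral (μ := μ) (f := f) (p := 2) two_ne_zero

theorem conj_integral_ofReal_mul (K : X → X → ℝ) (f : X → ℂ) (s : X) :
    conj (∫ u, (K s u : ℂ) * f u ∂μ) = ∫ u, (K s u : ℂ) * conj (f u) ∂μ := by
  rw [← integral_conj]; simp

/-- Pointwise `a b ≤ max(a, b)² ≤ a² + b²`. -/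
theorem lintegral_mul_lt_top_of_sq {a b : X → ℝ≥0∞} (ha : AEMeasurable a μ)
    (h1 : ∫⁻ x, a x ^ 2 ∂μ < ⊤) (h2 : ∫⁻ x, b x ^ 2 ∂μ < ⊤) : ∫⁻ x, a x * b x ∂μ < ⊤ := by
  refine lt_of_le_of_lt (lintegral_mono fun x => ?_)
    ((lintegral_add_left' (ha.pow_const 2) _).trans_lt (ENNReal.add_lt_top.2 ⟨h1, h2⟩))
  rcases le_total (a x) (b x) with h | h
  · exact le_trans (by rw [sq]; gcongr) le_add_self
  · exact le_trans (by rw [sq]; gcongr) le_self_add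

/-- A measurable kernel whose absolute value defines a bounded operator on `L²`. -/
structure IsBoundedKernel (μ : Measure X) (K : X → X → ℝ) : Prop where
  measurable : Measurable (Function.uncurry K)
  bound : ∃ M : ℝ≥0, ∀ f : X → ℝ≥0∞, Measurable f →
    ∫⁻ s, (∫⁻ u, ‖K s u‖ₑ * f u ∂μ) ^ 2 ∂μ ≤ (M : ℝ≥0∞) ^ 2 * ∫⁻ u, f u ^ 2 ∂μ

namespace IsBoundedKernel

variable {K : X → X → ℝ}

theorem stronglyMeasurable_mul (hK : IsBoundedKernel μ K) {f : X → ℂ} (hf : StronglyMeasurable f) :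
    StronglyMeasurable (Function.uncurry fun s u => (K s u : ℂ) * f u) := by
  have h1 : StronglyMeasurable (fun q : X × X => ((K q.1 q.2 : ℝ) : ℂ)) :=
    (Complex.measurable_ofReal.comp hK.measurable).stronglyMeasurable
  exact h1.mul (hf.comp_measurable measurable_snd)

theorem lintegral_sq_lt_top (hK : IsBoundedKernel μ K) {f : X → ℂ} (hf : StronglyMeasurable f) (hf2 : MemLp f 2 μ) :
    ∫⁻ s, (∫⁻ u, ‖(K s u : ℂ) * f u‖ₑ ∂μ) ^ 2 ∂μ < ⊤ := by
  obtain ⟨M, hM⟩ := hK.bound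
  have := hM (fun u => ‖f u‖ₑ) hf.enorm
  rw [← eLpNorm_two_sq] at this
  simp only [enorm_mul, Complex.enorm_ofReal_eq]
  exact this.trans_lt (ENNReal.mul_lt_top (by simp) (ENNReal.pow_lt_top hf2.eLpNorm_lt_top))

theorem exists_eLpNorm_le (hK : IsBoundedKernel μ K) : ∃ M : ℝ≥0, ∀ f : X → ℂ, StronglyMeasurable f →
    eLpNorm (fun s => ∫ u, (K s u : ℂ) * f u ∂μ) 2 μ ≤ M * eLpNorm f 2 μ := by
  obtain ⟨M, hM⟩ := hK.bound
  refine ⟨M, fun f hf => ?_⟩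
  rw [← ENNReal.pow_le_pow_left_iff two_ne_zero, mul_pow, eLpNorm_two_sq, eLpNorm_two_sq]
  refine le_trans (lintegral_mono fun s => ?_) (hM (fun u => ‖f u‖ₑ) hf.enorm)
  refine pow_le_pow_left' ((enorm_integral_le_lintegral_enorm _).trans_eq ?_) 2
  simp only [enorm_mul, Complex.enorm_ofReal_eq]

variable [SFinite μ]

/-- The function `s ↦ ∫ |K(s,u) f(u)| du` has finite L² norm, hence is finite almost everywhere. -/
theorem ae_integrable (hK : IsBoundedKernel μ K) {f : X → ℂ} (hf : StronglyMeasurable f) (hf2 : MemLp f 2 μ) :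
    ∀ᵐ s ∂μ, Integrable (fun u => (K s u : ℂ) * f u) μ := by
  have hm := (hK.stronglyMeasurable_mul hf)
  have h := ae_lt_top ((hm.enorm.lintegral_prod_right').pow_const 2)
    (hK.lintegral_sq_lt_top hf hf2).ne
  filter_upwards [h] with s hs
  refine ⟨hm.of_uncurry_left.aestronglyMeasurable, ?_⟩
  by_contra hc
  rw [HasFiniteIntegral, not_lt, top_le_iff] at hc
  simp only [Function.uncurry, hc] at hs
  simp at hs

theorem memLp (hK : IsBoundedKernel μ K) {f : X → ℂ} (hf : StronglyMeasurable f) (hf2 : MemLp f 2 μ) :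
    MemLp (fun s => ∫ u, (K s u : ℂ) * f u ∂μ) 2 μ := by
  obtain ⟨M, hM⟩ := hK.exists_eLpNorm_le
  exact ⟨(hK.stronglyMeasurable_mul hf).integral_prod_right'.aestronglyMeasurable,
    (hM f hf).trans_lt (ENNReal.mul_lt_top (by simp) hf2.eLpNorm_lt_top)⟩

/-- The operator on `L²` given by a bounded kernel. -/
noncomputable def op (hK : IsBoundedKernel μ K) : Lp ℂ 2 μ →L[ℂ] Lp ℂ 2 μ :=
  LinearMap.mkContinuousOfExistsBound
    { toFun := fun f => (hK.memLp (Lp.stronglyMeasurable f) (Lp.memLp f)).toLp _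
      map_add' := fun f g => by
        rw [← MemLp.toLp_add]
        refine MemLp.toLp_congr _ _ ?_
        filter_upwards [hK.ae_integrable (Lp.stronglyMeasurable f) (Lp.memLp f),
          hK.ae_integrable (Lp.stronglyMeasurable g) (Lp.memLp g)] with s h1 h2
        rw [Pi.add_apply, ← integral_add h1 h2]
        refine integral_congr_ae ?_
        filter_upwards [Lp.coeFn_add f g] with u hu
        rw [hu, Pi.add_apply, mul_add]
      map_smul' := fun c f => by
        rw [RingHom.id_apply, ← MemLp.toLp_const_smul]
        refine MemLp.toLp_congr _ _ (Filter.Eventually.of_forall fun s => ?_)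
        rw [Pi.smul_apply, smul_eq_mul, ← integral_const_mul]
        refine integral_congr_ae ?_
        filter_upwards [Lp.coeFn_smul c f] with u hu
        rw [hu, Pi.smul_apply, smul_eq_mul, mul_left_comm] }
    (by
      obtain ⟨M, hM⟩ := hK.exists_eLpNorm_le
      refine ⟨M, fun f => ?_⟩
      have := hM f (Lp.stronglyMeasurable f)
      simp only [LinearMap.coe_mk, AddHom.coe_mk, Lp.norm_toLp]
      refine (ENNReal.toReal_mono (ENNReal.mul_lt_top (by simp) (Lp.eLpNorm_lt_top f)).ne
        this).trans_eq ?_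
      simp [Lp.norm_def])

theorem coeFn_op (hK : IsBoundedKernel μ K) (f : Lp ℂ 2 μ) : hK.op f =ᵐ[μ] fun s => ∫ u, (K s u : ℂ) * f u ∂μ :=
  MemLp.coeFn_toLp (hK.memLp (Lp.stronglyMeasurable f) (Lp.memLp f))

theorem op_eq_of_ae_eq (hK : IsBoundedKernel μ K) {f g : Lp ℂ 2 μ}
    (h : ∀ᵐ s ∂μ, g s = ∫ u, (K s u : ℂ) * f u ∂μ) : hK.op f = g :=
  Lp.ext ((hK.coeFn_op f).trans (h.mono fun _ hs => hs.symm))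

/-- Expresses the form `⟪T f, T g⟫` through the kernel `∫ K(s,u) K(s,v) ds` of `T*T`; normality then
becomes an identity between two such kernels. -/
theorem inner_op_op (hK : IsBoundedKernel μ K) (f g : Lp ℂ 2 μ) :
    ⟪hK.op f, hK.op g⟫_ℂ =
      ∫ u, ∫ v, conj (f u) * g v * ((∫ s, K s u * K s v ∂μ : ℝ) : ℂ) ∂μ ∂μ := by
  have hf := Lp.stronglyMeasurable f
  have hg := Lp.stronglyMeasurable g
  have hf' : StronglyMeasurable fun x => conj (f x) := Complex.continuous_conj.comp_stronglyMeasurable hf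
  have hf2 : MemLp (fun x => conj (f x)) 2 μ := (Lp.memLp f).star
  rw [L2.inner_def]
  calc ∫ s, ⟪hK.op f s, hK.op g s⟫_ℂ ∂μ
      = ∫ s, (∫ u, (K s u : ℂ) * conj (f u) ∂μ) * (∫ v, (K s v : ℂ) * g v ∂μ) ∂μ := by
        refine integral_congr_ae ?_
        filter_upwards [hK.coeFn_op f, hK.coeFn_op g] with s h1 h2
        rw [h1, h2, RCLike.inner_apply, conj_integral_ofReal_mul, mul_comm]
    _ = ∫ u, ∫ v, ∫ s, ((K s u : ℂ) * conj (f u)) * ((K s v : ℂ) * g v) ∂μ ∂μ ∂μ :=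
        integral_integral_mul_integral (hK.stronglyMeasurable_mul hf') (hK.stronglyMeasurable_mul hg)
          (lintegral_mul_lt_top_of_sq
            (hK.stronglyMeasurable_mul hf').enorm.lintegral_prod_right'.aemeasurable
            (hK.lintegral_sq_lt_top hf' hf2) (hK.lintegral_sq_lt_top hg (Lp.memLp g))).ne
    _ = _ := by
        congr 1; ext u; congr 1; ext v
        rw [← integral_complex_ofReal, ← integral_const_mul]
        congr 1; ext s; push_cast; ring

theorem inner_op_left (hK : IsBoundedKernel μ K) {K' : X → X → ℝ} (hK' : IsBoundedKernel μ K')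
    (h : ∀ᵐ u ∂μ, ∀ᵐ s ∂μ, K' u s = K s u) (f g : Lp ℂ 2 μ) :
    ⟪hK.op f, g⟫_ℂ = ⟪f, hK'.op g⟫_ℂ := by
  have hf := Lp.stronglyMeasurable f
  have hg := Lp.stronglyMeasurable g
  have hf' : StronglyMeasurable fun x => conj (f x) := Complex.continuous_conj.comp_stronglyMeasurable hf
  have hf2 : MemLp (fun x => conj (f x)) 2 μ := (Lp.memLp f).star
  -- A Dirac mass on a one-point space as third factor reduces the triple Fubini to the double one.
  have key := integral_integral_mul_integral (μ := μ) (ν := μ) (ρ := Measure.dirac ())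
    (F := fun s u => (K s u : ℂ) * conj (f u)) (G := fun s _ => g s)
    (hK.stronglyMeasurable_mul hf') (hg.comp_measurable measurable_fst) (by
      simp only [lintegral_dirac]
      refine (lintegral_mul_lt_top_of_sq
            (hK.stronglyMeasurable_mul hf').enorm.lintegral_prod_right'.aemeasurable
            (hK.lintegral_sq_lt_top hf' hf2) ?_).ne
      rw [← eLpNorm_two_sq]
      exact ENNReal.pow_lt_top (Lp.eLpNorm_lt_top g))
  simp only [integral_dirac] at key
  rw [L2.inner_def, L2.inner_def]
  calc ∫ s, ⟪hK.op f s, g s⟫_ℂ ∂μ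
      = ∫ s, (∫ u, (K s u : ℂ) * conj (f u) ∂μ) * g s ∂μ := by
        refine integral_congr_ae ?_
        filter_upwards [hK.coeFn_op f] with s h1
        rw [h1, RCLike.inner_apply, conj_integral_ofReal_mul, mul_comm]
    _ = _ := key
    _ = _ := by
        refine integral_congr_ae ?_
        filter_upwards [hK'.coeFn_op g, h] with u h1 h2
        rw [h1, RCLike.inner_apply, mul_comm, ← integral_const_mul]
        refine integral_congr_ae ?_
        filter_upwards [h2] with s hs
        rw [hs]; ring

end IsBoundedKernel

end Kernel

/-! ### The Cesàro kernel: homogeneity, symmetry and boundedness -/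

namespace CesaroHardy

open scoped ENNReal NNReal InnerProductSpace ComplexConjugate

/-- The kernel of the Cesàro operator of order `α`. -/
noncomputable def cesaroKernel (α s u : ℝ) : ℝ :=
  if u < s then α / s ^ α * (s - u) ^ (α - 1) else 0

variable {α : ℝ}

theorem measurable_cesaroKernel (α : ℝ) : Measurable (Function.uncurry (cesaroKernel α)) := by
  refine Measurable.ite (measurableSet_lt measurable_snd measurable_fst) ?_ measurable_const
  fun_prop

theorem cesaroKernel_homogeneous {c s : ℝ} (hc : 0 < c) (hs : 0 < s) (u : ℝ) :
    cesaroKernel α (c * s) (c * u) = c⁻¹ * cesaroKernel α s u := by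
  unfold cesaroKernel
  by_cases h : u < s
  · have h' : 0 ≤ s - u := by linarith
    rw [if_pos h, if_pos (by gcongr), ← mul_sub, Real.mul_rpow hc.le hs.le, Real.mul_rpow hc.le h',
      Real.rpow_sub_one hc.ne']
    have := (Real.rpow_pos_of_pos hc α).ne'
    have := (Real.rpow_pos_of_pos hs α).ne'
    field_simp
  · rw [if_neg h, if_neg (by simpa [hc] using h), mul_zero]

/-- This is the normality of `𝒞_α` at kernel level. Under `s ↦ u v / s` homogeneity yields the
factors `s/u` and `s/v`, whose product cancels the Jacobian `u v / s²`; the two kernel factors trade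
places. -/
theorem integral_cesaroKernel_mul_comm {u v : ℝ} (hu : 0 < u) (hv : 0 < v) :
    ∫ s, cesaroKernel α s u * cesaroKernel α s v ∂halfLine =
      ∫ s, cesaroKernel α u s * cesaroKernel α v s ∂halfLine := by
  have himg : (fun s : ℝ => u * v / s) '' Set.Ioi 0 = Set.Ioi 0 := by
    ext y
    constructor
    · rintro ⟨s, hs, rfl⟩
      have : (0 : ℝ) < s := hs
      exact div_pos (mul_pos hu hv) this
    · intro hy
      have : (0 : ℝ) < y := hy
      exact ⟨u * v / y, div_pos (mul_pos hu hv) this, by simp only; field_simp⟩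
  have h := integral_image_eq_integral_abs_deriv_smul (s := Set.Ioi (0 : ℝ))
    (f := fun s => u * v / s) (f' := fun s => u * v * (-(s ^ 2)⁻¹)) measurableSet_Ioi
    (fun x hx => by
      simpa only [div_eq_mul_inv] using
        ((hasDerivAt_inv (ne_of_gt hx)).const_mul (u * v)).hasDerivWithinAt)
    (fun x hx y hy hxy => by
      have hx : (0 : ℝ) < x := hx
      have hy : (0 : ℝ) < y := hy
      have : u * v ≠ 0 := by positivity
      simp only at hxy
      rw [div_eq_div_iff hx.ne' hy.ne'] at hxy
      exact (mul_left_cancel₀ this hxy).symm)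
    (fun s => cesaroKernel α s u * cesaroKernel α s v)
  rw [himg] at h
  rw [h]
  refine setIntegral_congr_fun measurableSet_Ioi fun s hs => ?_
  have hs : (0 : ℝ) < s := hs
  -- Homogeneity with scale `u / s` applied to the pair `(v, s)`.
  have e1 : cesaroKernel α (u * v / s) u = s / u * cesaroKernel α v s := by
    have := cesaroKernel_homogeneous (α := α) (div_pos hu hs) hv s
    rwa [inv_div, div_mul_cancel₀ _ hs.ne', div_mul_eq_mul_div] at this
  have e2 : cesaroKernel α (u * v / s) v = s / v * cesaroKernel α u s := by
    have := cesaroKernel_homogeneous (α := α) (div_pos hv hs) hu s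
    rwa [inv_div, div_mul_cancel₀ _ hs.ne', div_mul_eq_mul_div, mul_comm v u] at this
  simp only [e1, e2, smul_eq_mul, mul_neg, abs_neg]
  rw [abs_of_pos (by positivity)]
  field_simp

/-- Substitution `u = s x` in an integral against the Cesàro kernel. -/
theorem lintegral_cesaroKernel (hα : 0 < α) {s : ℝ} (hs : 0 < s) (g : ℝ → ℝ≥0∞) :
    ∫⁻ u, ‖cesaroKernel α s u‖ₑ * g u ∂halfLine =
      ∫⁻ x in Set.Ioo (0 : ℝ) 1, ENNReal.ofReal (α * (1 - x) ^ (α - 1)) * g (s * x) := by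
  have himg : (fun x : ℝ => s * x) '' Set.Ioo 0 1 = Set.Ioo 0 s := by
    rw [Set.image_mul_left_Ioo hs]; simp
  calc ∫⁻ u, ‖cesaroKernel α s u‖ₑ * g u ∂halfLine
      = ∫⁻ u in Set.Ioo 0 s, ‖cesaroKernel α s u‖ₑ * g u := by
        rw [← lintegral_indicator measurableSet_Ioi, ← lintegral_indicator measurableSet_Ioo]
        congr 1; ext u
        by_cases h0 : 0 < u <;> by_cases h1 : u < s <;> simp [h0, h1, cesaroKernel]
    _ = ∫⁻ x in Set.Ioo (0 : ℝ) 1, ENNReal.ofReal |s| * (‖cesaroKernel α s (s * x)‖ₑ * g (s * x)) := by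
        rw [← himg]
        exact lintegral_image_eq_lintegral_abs_deriv_mul measurableSet_Ioo
          (fun x _ => by simpa using ((hasDerivAt_id x).const_mul s).hasDerivWithinAt)
          ((mul_right_injective₀ hs.ne').injOn) _
    _ = _ := by
        refine setLIntegral_congr_fun measurableSet_Ioo fun x hx => ?_
        have h := cesaroKernel_homogeneous (α := α) hs one_pos x
        rw [mul_one] at h
        have hx1 : 0 < 1 - x := by linarith [hx.2]
        have h2 : 0 ≤ α * (1 - x) ^ (α - 1) := by positivity
        simp only [h, ← mul_assoc]
        rw [Real.enorm_eq_ofReal_abs, ← ENNReal.ofReal_mul (abs_nonneg _), ← abs_mul,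
          mul_inv_cancel_left₀ hs.ne', cesaroKernel, if_pos hx.2, Real.one_rpow, div_one,
          abs_of_nonneg h2]

/-- Substitution `u = s / x` in an integral against the transposed Cesàro kernel. -/
theorem lintegral_cesaroKernel_transpose (hα : 0 < α) {s : ℝ} (hs : 0 < s) (g : ℝ → ℝ≥0∞) :
    ∫⁻ u, ‖cesaroKernel α u s‖ₑ * g u ∂halfLine =
      ∫⁻ x in Set.Ioo (0 : ℝ) 1, ENNReal.ofReal (α * (1 - x) ^ (α - 1)) *
        (ENNReal.ofReal x⁻¹ * g (s / x)) := by
  have himg : (fun x : ℝ => s / x) '' Set.Ioo 0 1 = Set.Ioi s := by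
    ext y
    constructor
    · rintro ⟨x, hx, rfl⟩
      exact (lt_div_iff₀ hx.1).2 (by nlinarith [hx.2])
    · intro hy
      have hy : s < y := hy
      have hy0 : 0 < y := hs.trans hy
      exact ⟨s / y, ⟨div_pos hs hy0, (div_lt_one hy0).2 hy⟩, by simp only; field_simp⟩
  calc ∫⁻ u, ‖cesaroKernel α u s‖ₑ * g u ∂halfLine
      = ∫⁻ u in Set.Ioi s, ‖cesaroKernel α u s‖ₑ * g u := by
        rw [← lintegral_indicator measurableSet_Ioi, ← lintegral_indicator measurableSet_Ioi]
        congr 1; ext u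
        by_cases h1 : s < u
        · simp [h1, cesaroKernel, hs.trans h1]
        · simp [h1, cesaroKernel]
    _ = ∫⁻ x in Set.Ioo (0 : ℝ) 1, ENNReal.ofReal |s * (-(x ^ 2)⁻¹)| *
          (‖cesaroKernel α (s / x) s‖ₑ * g (s / x)) := by
        rw [← himg]
        refine lintegral_image_eq_lintegral_abs_deriv_mul (f' := fun x => s * (-(x ^ 2)⁻¹))
          measurableSet_Ioo
          (fun x hx => by
            simpa only [div_eq_mul_inv] using
              ((hasDerivAt_inv (ne_of_gt hx.1)).const_mul s).hasDerivWithinAt)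
          (fun x hx y hy hxy => by
            rw [div_eq_div_iff hx.1.ne' hy.1.ne'] at hxy
            exact (mul_left_cancel₀ hs.ne' hxy).symm) _
    _ = _ := by
        refine setLIntegral_congr_fun measurableSet_Ioo fun x hx => ?_
        have hx0 := hx.1
        have h := cesaroKernel_homogeneous (α := α) (div_pos hs hx0) one_pos x
        rw [mul_one, div_mul_cancel₀ _ hx0.ne', inv_div] at h
        have hx1 : 0 < 1 - x := by linarith [hx.2]
        have h2 : 0 ≤ α * (1 - x) ^ (α - 1) := by positivity
        simp only [h, ← mul_assoc]
        rw [Real.enorm_eq_ofReal_abs, ← ENNReal.ofReal_mul (abs_nonneg _), ← abs_mul,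
          cesaroKernel, if_pos hx.2, Real.one_rpow, div_one, ← ENNReal.ofReal_mul h2,
          show s * (-(x ^ 2)⁻¹) * (x / s * (α * (1 - x) ^ (α - 1))) =
            -(α * (1 - x) ^ (α - 1) * x⁻¹) by field_simp, abs_neg, abs_of_nonneg (by positivity)]

/-- The integral is `α B(1/2, α)`. -/
theorem lintegral_beta_lt_top (hα : 0 < α) :
    ∫⁻ x in Set.Ioo (0 : ℝ) 1, ENNReal.ofReal (α * (1 - x) ^ (α - 1)) *
      ENNReal.ofReal (x ^ (-(1 / 2) : ℝ)) < ⊤ := by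
  have h := (Complex.betaIntegral_convergent (u := (1 / 2 : ℝ)) (v := (α : ℝ))
    (by norm_num) (by simpa))
  rw [intervalIntegrable_iff_integrableOn_Ioo_of_le zero_le_one] at h
  have h2 := (h.const_mul (α : ℂ)).2
  rw [HasFiniteIntegral] at h2
  refine lt_of_le_of_lt (setLIntegral_mono_ae' measurableSet_Ioo
    (Filter.Eventually.of_forall fun x hx => ?_)) h2
  have hx0 := hx.1
  have hx1 : 0 < 1 - x := by linarith [hx.2]
  rw [← ENNReal.ofReal_mul (by positivity), ← ofReal_norm]
  refine ENNReal.ofReal_le_ofReal (le_of_eq ?_)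
  rw [norm_mul, norm_mul, Complex.norm_cpow_eq_rpow_re_of_pos hx0,
    show (1 : ℂ) - (x : ℂ) = ((1 - x : ℝ) : ℂ) by push_cast; ring,
    Complex.norm_cpow_eq_rpow_re_of_pos hx1, Complex.norm_real, Real.norm_of_nonneg hα.le]
  have e1 : (((1 / 2 : ℝ) : ℂ) - 1).re = -(1 / 2) := by norm_num
  have e2 : ((α : ℂ) - 1).re = α - 1 := by simp
  rw [e1, e2]
  ring

/-- By homogeneity, integrating a power weight against the kernel in either variable reproduces the
power. The exponent `-1/2` gives both integrals the same constant `α B(1/2, α)`, since `x⁻¹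
(s/x)^{-1/2} = x^{-1/2} s^{-1/2}`. -/
theorem schur_cesaroKernel (hα : 0 < α) :
    ∃ M : ℝ≥0, (∀ s : ℝ, 0 < s →
      ∫⁻ u, ‖cesaroKernel α s u‖ₑ * ENNReal.ofReal (u ^ (-(1 / 2) : ℝ)) ∂halfLine ≤
        M * ENNReal.ofReal (s ^ (-(1 / 2) : ℝ))) ∧ ∀ s : ℝ, 0 < s →
      ∫⁻ u, ‖cesaroKernel α u s‖ₑ * ENNReal.ofReal (u ^ (-(1 / 2) : ℝ)) ∂halfLine ≤
        M * ENNReal.ofReal (s ^ (-(1 / 2) : ℝ)) := by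
  lift (∫⁻ x in Set.Ioo (0 : ℝ) 1, ENNReal.ofReal (α * (1 - x) ^ (α - 1)) *
      ENNReal.ofReal (x ^ (-(1 / 2) : ℝ))) to ℝ≥0 using (lintegral_beta_lt_top hα).ne with M hM
  refine ⟨M, fun s hs => ?_, fun s hs => ?_⟩
  · rw [lintegral_cesaroKernel hα hs, hM, ← lintegral_mul_const' _ _ ENNReal.ofReal_ne_top]
    refine (setLIntegral_congr_fun measurableSet_Ioo fun x hx => ?_).le
    rw [mul_assoc, ← ENNReal.ofReal_mul (Real.rpow_nonneg hx.1.le _), mul_comm s x,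
      Real.mul_rpow hx.1.le hs.le]
  · rw [lintegral_cesaroKernel_transpose hα hs, hM, ← lintegral_mul_const' _ _ ENNReal.ofReal_ne_top]
    refine (setLIntegral_congr_fun measurableSet_Ioo fun x hx => ?_).le
    have hx0 := hx.1
    rw [mul_assoc, ← ENNReal.ofReal_mul (Real.rpow_nonneg hx.1.le _),
      ← ENNReal.ofReal_mul (by positivity), Real.div_rpow hs.le hx0.le,
      show x⁻¹ * (s ^ (-(1 / 2) : ℝ) / x ^ (-(1 / 2) : ℝ)) =
        x ^ (-(1 / 2) : ℝ) * s ^ (-(1 / 2) : ℝ) by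
        have : x⁻¹ = x ^ (-(1 / 2) : ℝ) * x ^ (-(1 / 2) : ℝ) := by
          rw [← Real.rpow_add hx0, ← Real.rpow_neg_one]; norm_num
        have h' := (Real.rpow_pos_of_pos hx0 (-(1 / 2))).ne'
        rw [this]; field_simp]

theorem ae_halfLine_pos : ∀ᵐ s ∂halfLine, 0 < s := ae_restrict_mem measurableSet_Ioi

theorem isBoundedKernel_cesaro (hα : 0 < α) : IsBoundedKernel halfLine (cesaroKernel α) where
  measurable := measurable_cesaroKernel α
  bound := by
    obtain ⟨M, h1, h2⟩ := schur_cesaroKernel hα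
    refine ⟨M, fun f hf => lintegral_sq_lintegral_mul_le
      (p := fun u => ENNReal.ofReal (u ^ (-(1 / 2) : ℝ)))
      (measurable_cesaroKernel α).enorm hf (by fun_prop) ?_ (by simp)
      (ae_halfLine_pos.mono h1) (ae_halfLine_pos.mono h2)⟩
    filter_upwards [ae_halfLine_pos] with x hx
    simpa using Real.rpow_pos_of_pos hx _

theorem isBoundedKernel_cesaroStar (hα : 0 < α) :
    IsBoundedKernel halfLine (fun s u => cesaroKernel α u s) where
  measurable := (measurable_cesaroKernel α).comp measurable_swap
  bound := by
    obtain ⟨M, h1, h2⟩ := schur_cesaroKernel hα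
    refine ⟨M, fun f hf => lintegral_sq_lintegral_mul_le
      (p := fun u => ENNReal.ofReal (u ^ (-(1 / 2) : ℝ)))
      ((measurable_cesaroKernel α).comp measurable_swap).enorm hf (by fun_prop) ?_ (by simp)
      (ae_halfLine_pos.mono h2) (ae_halfLine_pos.mono h1)⟩
    filter_upwards [ae_halfLine_pos] with x hx
    simpa using Real.rpow_pos_of_pos hx _

end CesaroHardy

/-! ### The operators on L₂, normality, and the Laplace transform -/

namespace CesaroHardy

open scoped ENNReal NNReal InnerProductSpace ComplexConjugate

variable {α : ℝ}

theorem cesaroKernel_smul_eq_indicator (f : ℝ → ℂ) (s : ℝ) :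
    (fun u => (cesaroKernel α s u : ℂ) * f u) =
      (Set.Iio s).indicator fun u => ((α / s ^ α : ℝ) : ℂ) * ((s - u) ^ (α - 1) • f u) := by
  ext u
  by_cases h : u < s
  · simp [cesaroKernel, h, mul_assoc]
  · simp [cesaroKernel, h]

theorem cesaroKernel_transpose_smul_eq_indicator (f : ℝ → ℂ) (s : ℝ) :
    (fun u => (cesaroKernel α u s : ℂ) * f u) =
      (Set.Ioi s).indicator fun u => (α : ℂ) * (((u - s) ^ (α - 1) / u ^ α) • f u) := by
  ext u
  by_cases h : s < u
  · simp [cesaroKernel, h]; ring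
  · simp [cesaroKernel, h]

theorem halfLine_restrict_Iio (s : ℝ) : halfLine.restrict (Set.Iio s) = volume.restrict (Set.Ioo 0 s) := by
  rw [Measure.restrict_restrict measurableSet_Iio, Set.Iio_inter_Ioi]

theorem halfLine_restrict_Ioi {s : ℝ} (hs : 0 ≤ s) :
    halfLine.restrict (Set.Ioi s) = volume.restrict (Set.Ioi s) := by
  rw [Measure.restrict_restrict measurableSet_Ioi, Set.Ioi_inter_Ioi, max_eq_left hs]

theorem cesaroFun_eq (f : ℝ → ℂ) (s : ℝ) :
    cesaroFun α f s = ∫ u, (cesaroKernel α s u : ℂ) * f u ∂halfLine := by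
  rw [cesaroKernel_smul_eq_indicator, integral_indicator measurableSet_Iio, halfLine_restrict_Iio,
    integral_const_mul, cesaroFun, Complex.real_smul]

theorem cesaroStarFun_eq (f : ℝ → ℂ) {s : ℝ} (hs : 0 ≤ s) :
    cesaroStarFun α f s = ∫ u, (cesaroKernel α u s : ℂ) * f u ∂halfLine := by
  rw [cesaroKernel_transpose_smul_eq_indicator, integral_indicator measurableSet_Ioi,
    halfLine_restrict_Ioi hs, integral_const_mul, cesaroStarFun, Complex.real_smul]

theorem ae_integrableOn_cesaro (hα : 0 < α) (f : L2) :
    ∀ᵐ s ∂halfLine, IntegrableOn (fun u => (s - u) ^ (α - 1) • f u) (Set.Ioo 0 s) := by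
  filter_upwards [(isBoundedKernel_cesaro hα).ae_integrable (Lp.stronglyMeasurable f) (Lp.memLp f),
    ae_halfLine_pos] with s hs h0
  rw [cesaroKernel_smul_eq_indicator, integrable_indicator_iff measurableSet_Iio, IntegrableOn,
    halfLine_restrict_Iio] at hs
  have hne : ((α / s ^ α : ℝ) : ℂ) ≠ 0 := by
    have := Real.rpow_pos_of_pos h0 α
    exact_mod_cast (div_pos hα this).ne'
  exact (integrable_const_mul_iff hne.isUnit _).1 hs

theorem ae_integrableOn_cesaroStar (hα : 0 < α) (f : L2) :
    ∀ᵐ s ∂halfLine, IntegrableOn (fun u => ((u - s) ^ (α - 1) / u ^ α) • f u) (Set.Ioi s) := by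
  filter_upwards [(isBoundedKernel_cesaroStar hα).ae_integrable (Lp.stronglyMeasurable f)
    (Lp.memLp f), ae_halfLine_pos] with s hs h0
  rw [cesaroKernel_transpose_smul_eq_indicator, integrable_indicator_iff measurableSet_Ioi,
    IntegrableOn, halfLine_restrict_Ioi h0.le] at hs
  have hne : (α : ℂ) ≠ 0 := by exact_mod_cast hα.ne'
  exact (integrable_const_mul_iff hne.isUnit _).1 hs

theorem memLp_cesaroFun (hα : 0 < α) (f : L2) : MemLp (cesaroFun α f) 2 halfLine := by
  rw [show cesaroFun α f = _ from funext (cesaroFun_eq f)]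
  exact (isBoundedKernel_cesaro hα).memLp (Lp.stronglyMeasurable f) (Lp.memLp f)

theorem cesaroStarFun_ae_eq (f : ℝ → ℂ) : cesaroStarFun α f =ᵐ[halfLine]
    fun s => ∫ u, (cesaroKernel α u s : ℂ) * f u ∂halfLine :=
  ae_halfLine_pos.mono fun _ hs => cesaroStarFun_eq f hs.le

theorem memLp_cesaroStarFun (hα : 0 < α) (f : L2) : MemLp (cesaroStarFun α f) 2 halfLine :=
  (memLp_congr_ae (cesaroStarFun_ae_eq f)).2
    ((isBoundedKernel_cesaroStar hα).memLp (Lp.stronglyMeasurable f) (Lp.memLp f))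

/-- `𝒞_α` as a continuous linear map. -/
noncomputable def cesaroL (hα : 0 < α) : L2 →L[ℂ] L2 := (isBoundedKernel_cesaro hα).op

/-- `𝒞*_α` as a continuous linear map. -/
noncomputable def cesaroStarL (hα : 0 < α) : L2 →L[ℂ] L2 := (isBoundedKernel_cesaroStar hα).op

theorem coeFn_cesaro (hα : 0 < α) (f : L2) : cesaro α f =ᵐ[halfLine] cesaroFun α f := by
  rw [cesaro, dif_pos (memLp_cesaroFun hα f)]
  exact MemLp.coeFn_toLp _

theorem coeFn_cesaroStar (hα : 0 < α) (f : L2) :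
    cesaroStar α f =ᵐ[halfLine] cesaroStarFun α f := by
  rw [cesaroStar, dif_pos (memLp_cesaroStarFun hα f)]
  exact MemLp.coeFn_toLp _

theorem coe_cesaroL (hα : 0 < α) : ⇑(cesaroL hα) = cesaro α :=
  funext fun f => (isBoundedKernel_cesaro hα).op_eq_of_ae_eq
    ((coeFn_cesaro hα f).trans (.of_forall (cesaroFun_eq f)))

theorem coe_cesaroStarL (hα : 0 < α) : ⇑(cesaroStarL hα) = cesaroStar α :=
  funext fun f => (isBoundedKernel_cesaroStar hα).op_eq_of_ae_eq
    ((coeFn_cesaroStar hα f).trans (cesaroStarFun_ae_eq f))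

theorem inner_cesaroL_left (hα : 0 < α) (f g : L2) :
    ⟪cesaroL hα f, g⟫_ℂ = ⟪f, cesaroStarL hα g⟫_ℂ :=
  IsBoundedKernel.inner_op_left _ _ (.of_forall fun _ => .of_forall fun _ => rfl) f g

/-- Normality, read off from `integral_cesaroKernel_mul_comm` via the kernels of `𝒞*𝒞` and `𝒞𝒞*`. -/
theorem inner_cesaroL_cesaroL (hα : 0 < α) (f g : L2) :
    ⟪cesaroL hα f, cesaroL hα g⟫_ℂ = ⟪cesaroStarL hα f, cesaroStarL hα g⟫_ℂ := by
  rw [cesaroL, cesaroStarL, IsBoundedKernel.inner_op_op, IsBoundedKernel.inner_op_op]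
  refine integral_congr_ae ?_
  filter_upwards [ae_halfLine_pos] with u hu
  refine integral_congr_ae ?_
  filter_upwards [ae_halfLine_pos] with v hv
  rw [integral_cesaroKernel_mul_comm hu hv]

/-! ### The Laplace transform -/

theorem memLp_rpow_mul_exp {a : ℝ} (ha : 0 ≤ a) {w : ℂ} (hw : 0 < w.re) :
    MemLp (fun t : ℝ => ((t ^ a : ℝ) : ℂ) * Complex.exp (-w * t)) 2 halfLine := by
  have hm : Measurable (fun t : ℝ => ((t ^ a : ℝ) : ℂ) * Complex.exp (-w * t)) := by fun_prop
  rw [memLp_two_iff_integrable_sq_norm hm.aestronglyMeasurable]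
  have h := integrableOn_rpow_mul_exp_neg_mul_rpow (p := 1) (s := 2 * a) (b := 2 * w.re)
    (by linarith) one_pos (by linarith)
  refine (integrable_congr ?_).1 h
  filter_upwards [ae_halfLine_pos] with t ht
  rw [norm_mul, mul_pow, Complex.norm_exp, Complex.norm_real,
    Real.norm_of_nonneg (Real.rpow_nonneg ht.le _), ← Real.rpow_natCast (t ^ a), ← Real.rpow_mul ht.le,
    ← Real.exp_nat_mul, Real.rpow_one]
  simp
  ring_nf

theorem memLp_exp {w : ℂ} (hw : 0 < w.re) :
    MemLp (fun t : ℝ => Complex.exp (-w * t)) 2 halfLine := by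
  simpa using memLp_rpow_mul_exp le_rfl hw

/-- The vector of `L₂(ℝ⁺)` that represents evaluation of the Laplace transform at `w`. -/
noncomputable def expVec (w : HalfPlane) : L2 :=
  (memLp_exp (w := conj (w : ℂ)) (by simpa using w.2)).toLp _

theorem coeFn_expVec (w : HalfPlane) :
    expVec w =ᵐ[halfLine] fun t : ℝ => Complex.exp (-conj (w : ℂ) * t) :=
  MemLp.coeFn_toLp _

theorem laplace_eq_inner (f : L2) (w : HalfPlane) : laplace f w = ⟪expVec w, f⟫_ℂ := by
  rw [L2.inner_def, laplace]
  refine integral_congr_ae ?_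
  filter_upwards [coeFn_expVec w] with t ht
  rw [ht, RCLike.inner_apply, ← Complex.exp_conj]
  simp

/-- In the variable `x = e^{-t}` the hypothesis says that all moments vanish; polynomials are
uniformly dense in the continuous functions on `[0,1]`. -/
theorem integral_mul_comp_exp_eq_zero {F : ℝ → ℂ} (hF : Integrable F halfLine)
    (h : ∀ n : ℕ, ∫ t, F t * Complex.exp (-(n : ℂ) * t) ∂halfLine = 0)
    {φ : ℝ → ℝ} (hφ : ContinuousOn φ (Set.Icc 0 1)) :
    ∫ t, φ (Real.exp (-t)) • F t ∂halfLine = 0 := by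
  have hpoly : ∀ p : Polynomial ℝ, ∫ t, p.eval (Real.exp (-t)) • F t ∂halfLine = 0 ∧
      Integrable (fun t => p.eval (Real.exp (-t)) • F t) halfLine := by
    intro p
    have hmono : ∀ (n : ℕ) (a : ℝ),
        Integrable (fun t : ℝ => (a * Real.exp (-t) ^ n) • F t) halfLine := fun n a => by
      refine hF.bdd_smul |a|
        (Continuous.aestronglyMeasurable (f := fun t : ℝ => a * Real.exp (-t) ^ n) (by fun_prop)) ?_
      filter_upwards [ae_halfLine_pos] with t ht
      rw [norm_mul, norm_pow, Real.norm_eq_abs, Real.norm_of_nonneg (Real.exp_pos _).le]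
      exact mul_le_of_le_one_right (abs_nonneg _) (pow_le_one₀ (Real.exp_pos _).le (by simpa using ht.le))
    induction p using Polynomial.induction_on' with
    | add p q hp hq =>
      simp only [Polynomial.eval_add, add_smul]
      exact ⟨by rw [integral_add hp.2 hq.2, hp.1, hq.1, add_zero], hp.2.add hq.2⟩
    | monomial n a =>
      simp only [Polynomial.eval_monomial]
      refine ⟨?_, hmono n a⟩
      have := congrArg (fun z => (a : ℂ) * z) (h n)
      rw [← integral_const_mul, mul_zero] at this
      rw [← this]
      congr 1; ext t
      rw [← Real.exp_nat_mul, Complex.real_smul]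
      push_cast
      rw [mul_neg, neg_mul]; ring
  rw [← norm_le_zero_iff]
  refine le_of_forall_pos_le_add fun ε hε => ?_
  set I := ∫ t, ‖F t‖ ∂halfLine
  have hI : 0 ≤ I := integral_nonneg fun _ => norm_nonneg _
  obtain ⟨p, hp⟩ := exists_polynomial_near_of_continuousOn 0 1 φ hφ (ε / (I + 1)) (by positivity)
  have hmem : ∀ t : ℝ, 0 < t → Real.exp (-t) ∈ Set.Icc (0 : ℝ) 1 := fun t ht =>
    ⟨(Real.exp_pos _).le, by simpa using ht.le⟩
  have hle : ∀ᵐ t ∂halfLine, ‖φ (Real.exp (-t)) • F t - p.eval (Real.exp (-t)) • F t‖ ≤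
      ε / (I + 1) * ‖F t‖ := by
    filter_upwards [ae_halfLine_pos] with t ht
    rw [← sub_smul, norm_smul, norm_sub_rev]
    gcongr
    exact (hp _ (hmem t ht)).le
  by_cases hint : Integrable (fun t => φ (Real.exp (-t)) • F t) halfLine
  · calc ‖∫ t, φ (Real.exp (-t)) • F t ∂halfLine‖
        = ‖∫ t, (φ (Real.exp (-t)) • F t - p.eval (Real.exp (-t)) • F t) ∂halfLine‖ := by
          rw [integral_sub hint (hpoly p).2, (hpoly p).1, sub_zero]
      _ ≤ ∫ t, ε / (I + 1) * ‖F t‖ ∂halfLine :=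
          norm_integral_le_of_norm_le (hF.norm.const_mul _) hle
      _ = ε / (I + 1) * I := integral_const_mul _ _
      _ ≤ 0 + ε := by
          rw [zero_add, div_mul_eq_mul_div, div_le_iff₀ (by positivity)]
          nlinarith
  -- A non-integrable integrand has integral `0` by convention, so no integrability proof is needed.
  · rw [integral_undef hint]; simp [hε.le]

/-- The factor `e^{-t}` makes `F` integrable and accounts for the shift `n + 1`. A test function `g`
supported in `(0,∞)` has the form `φ(e^{-t})` with `φ(x) = g(-log x)`, so `F` annihilates all of
them. -/
theorem eq_zero_of_integral_mul_exp_eq_zero {f : L2}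
    (h : ∀ n : ℕ, ∫ t, f t * Complex.exp (-((n : ℂ) + 1) * t) ∂halfLine = 0) : f = 0 := by
  set F : ℝ → ℂ := fun t => f t * Complex.exp (-(1 : ℂ) * t)
  have hF : Integrable F halfLine := (Lp.memLp f).integrable_mul (memLp_exp (by simp))
  have hF0 : ∀ n : ℕ, ∫ t, F t * Complex.exp (-(n : ℂ) * t) ∂halfLine = 0 := fun n => by
    rw [← h n]
    congr 1; ext t
    rw [mul_assoc, ← Complex.exp_add]
    ring_nf
  have key := isOpen_Ioi.ae_eq_zero_of_integral_contDiff_smul_eq_zero (U := Set.Ioi (0 : ℝ))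
    (f := F) (μ := volume) (IntegrableOn.locallyIntegrableOn hF) fun g hg hgc hgs => by
      have hg0 : ∀ t : ℝ, t ≤ 0 → g t = 0 := fun t ht =>
        image_eq_zero_of_notMem_tsupport fun hc => not_lt.2 ht (hgs hc)
      rw [← setIntegral_eq_integral_of_forall_compl_eq_zero (s := Set.Ioi (0 : ℝ))
        (fun t ht => by rw [hg0 t (not_lt.1 ht), zero_smul])]
      have := integral_mul_comp_exp_eq_zero hF hF0 (φ := fun x => g (-Real.log x)) (by
        intro x hx
        rcases hx.1.eq_or_lt with rfl | hx0
        -- Continuity of `φ` at `0`: compact support makes it vanish for small `x > 0`, and at `x =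
        -- 0` the convention `log 0 = 0` gives `g 0 = 0`.
        · obtain ⟨R, hR⟩ := hgc.isCompact.isBounded.subset_closedBall 0
          have hev : ∀ᶠ x in nhdsWithin (0 : ℝ) (Set.Icc 0 1), g (-Real.log x) = 0 := by
            have hlt : Set.Iio (Real.exp (-R)) ∈ nhdsWithin (0 : ℝ) (Set.Icc 0 1) :=
              mem_nhdsWithin_of_mem_nhds (Iio_mem_nhds (Real.exp_pos _))
            filter_upwards [hlt, self_mem_nhdsWithin] with y hy hy1
            rcases hy1.1.eq_or_lt with rfl | hy0
            · simpa using hg0 0 le_rfl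
            · refine image_eq_zero_of_notMem_tsupport fun hc => ?_
              have h1 := hR hc
              rw [mem_closedBall_zero_iff, Real.norm_eq_abs] at h1
              have h2 : Real.log y < -R := (Real.log_lt_iff_lt_exp hy0).2 hy
              linarith [le_abs_self (-Real.log y)]
          have h00 : g (-Real.log 0) = 0 := by simpa using hg0 0 le_rfl
          refine (continuousWithinAt_const (b := (0 : ℝ))).congr_of_eventuallyEq hev h00
        · exact (hg.continuous.continuousAt.comp
            (Real.continuousAt_log hx0.ne').neg).continuousWithinAt)
      simpa using this
  refine Lp.ext ?_
  filter_upwards [(ae_restrict_iff' measurableSet_Ioi).2 key, Lp.coeFn_zero ℂ 2 halfLine] with t ht h0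
  rw [h0, Pi.zero_apply]
  exact (mul_eq_zero.1 ht).resolve_right (Complex.exp_ne_zero _)

theorem laplace_injective : Function.Injective laplace := by
  intro f g hfg
  rw [← sub_eq_zero]
  refine eq_zero_of_integral_mul_exp_eq_zero fun n => ?_
  have : laplace (f - g) ⟨(n : ℂ) + 1, by simp; positivity⟩ = 0 := by
    rw [laplace_eq_inner, inner_sub_right, ← laplace_eq_inner, ← laplace_eq_inner, hfg, sub_self]
  exact this

/-- `𝒞*_α` maps `t ^ α e ^ {-λ t}` to a multiple of `e ^ {-λ t}`. -/
theorem integral_cesaroKernel_transpose_rpow_mul_exp (hα : 0 < α) {l s : ℝ} (hl : 0 < l)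
    (hs : 0 < s) :
    ∫ u, (cesaroKernel α u s : ℂ) * (((u ^ α : ℝ) : ℂ) * Complex.exp (-(l : ℂ) * u)) ∂halfLine =
      ((α * ((1 / l) ^ α * Real.Gamma α) : ℝ) : ℂ) * Complex.exp (-(l : ℂ) * s) := by
  have e : ∀ u : ℝ, Complex.exp (-(l : ℂ) * u) = (Real.exp (-(l * u)) : ℂ) := fun u => by
    push_cast; ring_nf
  rw [cesaroKernel_transpose_smul_eq_indicator, integral_indicator measurableSet_Ioi,
    halfLine_restrict_Ioi hs.le, integral_const_mul]
  have h1 : ∫ u in Set.Ioi s, ((u - s) ^ (α - 1) / u ^ α) •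
        (((u ^ α : ℝ) : ℂ) * Complex.exp (-(l : ℂ) * u)) =
      ∫ u in Set.Ioi s, (((u - s) ^ (α - 1) * Real.exp (-(l * u)) : ℝ) : ℂ) := by
    refine setIntegral_congr_fun measurableSet_Ioi fun u hu => ?_
    have hu0 : 0 < u := hs.trans hu
    have := (Real.rpow_pos_of_pos hu0 α).ne'
    simp only [e, Complex.real_smul, ← Complex.ofReal_mul]
    congr 1
    field_simp
  -- Translation by `s` leaves a Gamma integral.
  have h2 : ∫ u in Set.Ioi s, (u - s) ^ (α - 1) * Real.exp (-(l * u)) =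
      Real.exp (-(l * s)) * ((1 / l) ^ α * Real.Gamma α) := by
    have := (measurePreserving_add_right volume s).setIntegral_preimage_emb
      (measurableEmbedding_addRight s) (fun u => (u - s) ^ (α - 1) * Real.exp (-(l * u))) (Set.Ioi s)
    rw [Set.preimage_add_const_Ioi, sub_self] at this
    rw [← this, ← Real.integral_rpow_mul_exp_neg_mul_Ioi hα hl, ← integral_const_mul]
    congr 1; ext u
    rw [add_sub_cancel_right, mul_add, neg_add, Real.exp_add]; ring
  rw [h1, integral_complex_ofReal, h2, e]
  push_cast; ring

/-- Pairing `𝒞 f = 0` with `t^α e^{-(n+1)t}` and moving `𝒞` across gives `ℒ f (n+1) = 0` for every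
`n`. -/
theorem cesaroL_injective (hα : 0 < α) : Function.Injective (cesaroL hα) := by
  rw [injective_iff_map_eq_zero]
  intro f hf
  refine eq_zero_of_integral_mul_exp_eq_zero fun n => ?_
  have hn : (0 : ℝ) < n + 1 := by positivity
  have hmem := memLp_rpow_mul_exp hα.le (w := ((n + 1 : ℝ) : ℂ)) (by simpa using hn)
  set g : L2 := hmem.toLp _
  have hc : (0 : ℝ) < α * ((1 / (n + 1 : ℝ)) ^ α * Real.Gamma α) := by
    have := Real.Gamma_pos_of_pos hα
    positivity
  have hg : cesaroStarL hα g = ((α * ((1 / (n + 1 : ℝ)) ^ α * Real.Gamma α) : ℝ) : ℂ) •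
      expVec ⟨(n + 1 : ℝ), by simpa using hn⟩ := by
    refine (isBoundedKernel_cesaroStar hα).op_eq_of_ae_eq ?_
    filter_upwards [Lp.coeFn_smul ((α * ((1 / (n + 1 : ℝ)) ^ α * Real.Gamma α) : ℝ) : ℂ)
      (expVec ⟨(n + 1 : ℝ), by simpa using hn⟩), coeFn_expVec ⟨(n + 1 : ℝ), by simpa using hn⟩,
      ae_halfLine_pos] with s h1 h2 hs
    rw [h1, Pi.smul_apply, h2, smul_eq_mul, Complex.conj_ofReal,
      ← integral_cesaroKernel_transpose_rpow_mul_exp hα hn hs]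
    refine integral_congr_ae ?_
    filter_upwards [hmem.coeFn_toLp] with u hu
    rw [hu]
  have h := inner_cesaroL_left hα f g
  rw [hf, inner_zero_left, hg, inner_smul_right, ← inner_conj_symm, ← laplace_eq_inner] at h
  have h' := (mul_eq_zero.1 h.symm).resolve_left (by exact_mod_cast hc.ne')
  have h'' : laplace f ⟨(n + 1 : ℝ), by simpa using hn⟩ = 0 := by simpa using h'
  rw [← h'', laplace]
  simp

/-- Normality gives `‖𝒞 f‖ = ‖𝒞* f‖`, so the kernels of the operators agree. -/
theorem cesaroStarL_injective (hα : 0 < α) : Function.Injective (cesaroStarL hα) :=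
  (injective_iff_map_eq_zero _).2 fun f hf => (injective_iff_map_eq_zero _).1 (cesaroL_injective hα) f <| by
    rw [← inner_self_eq_zero (𝕜 := ℂ), inner_cesaroL_cesaroL, hf, inner_zero_left]

end CesaroHardy

namespace CesaroHardy

open scoped ENNReal NNReal InnerProductSpace ComplexConjugate

variable {α : ℝ}

/-! ### The reproducing kernel -/

/-- Substitution `u = s x` in the integral that defines `𝒞_α`. -/
theorem integral_cesaroKernel {s : ℝ} (hs : 0 < s) (g : ℝ → ℂ) :
    ∫ u, (cesaroKernel α s u : ℂ) * g u ∂halfLine =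
      ∫ x in Set.Ioo (0 : ℝ) 1, ((α * (1 - x) ^ (α - 1) : ℝ) : ℂ) * g (s * x) := by
  have himg : (fun x : ℝ => s * x) '' Set.Ioo 0 1 = Set.Ioo 0 s := by
    rw [Set.image_mul_left_Ioo hs]; simp
  calc ∫ u, (cesaroKernel α s u : ℂ) * g u ∂halfLine
      = ∫ u in Set.Ioo 0 s, (cesaroKernel α s u : ℂ) * g u := by
        rw [← integral_indicator measurableSet_Ioi, ← integral_indicator measurableSet_Ioo]
        congr 1; ext u
        by_cases h0 : 0 < u <;> by_cases h1 : u < s <;> simp [h0, h1, cesaroKernel]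
    _ = ∫ x in Set.Ioo (0 : ℝ) 1, |s| • ((cesaroKernel α s (s * x) : ℂ) * g (s * x)) := by
        rw [← himg]
        exact integral_image_eq_integral_abs_deriv_smul measurableSet_Ioo
          (fun x _ => by simpa using ((hasDerivAt_id x).const_mul s).hasDerivWithinAt)
          ((mul_right_injective₀ hs.ne').injOn) _
    _ = _ := by
        refine setIntegral_congr_fun measurableSet_Ioo fun x hx => ?_
        have h := cesaroKernel_homogeneous (α := α) hs one_pos x
        rw [mul_one] at h
        simp only [h, Complex.real_smul, ← mul_assoc, ← Complex.ofReal_mul]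
        rw [abs_of_pos hs, mul_inv_cancel₀ hs.ne', one_mul, cesaroKernel, if_pos hx.2,
          Real.one_rpow, div_one]

theorem integral_exp_neg_mul_Ioi_of_re_pos {c : ℂ} (hc : 0 < c.re) :
    ∫ s in Set.Ioi (0 : ℝ), Complex.exp (-c * s) = 1 / c := by
  rw [integral_exp_mul_complex_Ioi (by simpa using hc)]
  simp

/-- After `u = s x`, each factor is an average of exponentials `e^{-c s x}`; Fubini leaves `∫
e^{-s(xz + y w̄)} ds = 1/(xz + y w̄)`. The constant is `α² = (Γ(α+1)/Γ(α))²`. -/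
theorem inner_cesaroL_expVec (hα : 0 < α) (z w : HalfPlane) :
    ⟪cesaroL hα (expVec z), cesaroL hα (expVec w)⟫_ℂ =
      (Real.Gamma (α + 1) : ℂ) ^ 2 * kernelK α z w := by
  have hz := z.2
  have hw := w.2
  let F : ℂ → ℝ → ℝ → ℂ := fun c s x =>
    ((α * (1 - x) ^ (α - 1) : ℝ) : ℂ) * Complex.exp (-c * ((s * x : ℝ) : ℂ))
  have hFm : ∀ c, StronglyMeasurable (Function.uncurry (F c)) := fun c => by
    refine Measurable.stronglyMeasurable ?_
    simp only [F, Function.uncurry_def]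
    fun_prop
  have hF2 : ∀ c : ℂ, 0 < c.re →
      ∫⁻ s, (∫⁻ x in Set.Ioo (0 : ℝ) 1, ‖F c s x‖ₑ) ^ 2 ∂halfLine < ⊤ := fun c hc => by
    refine lt_of_eq_of_lt ?_ ((isBoundedKernel_cesaro hα).lintegral_sq_lt_top
      (f := fun u : ℝ => Complex.exp (-c * u)) (Measurable.stronglyMeasurable (by fun_prop))
      (memLp_exp hc))
    refine setLIntegral_congr_fun measurableSet_Ioi fun s hs => ?_
    simp only [enorm_mul, Complex.enorm_ofReal_eq]
    rw [lintegral_cesaroKernel hα hs]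
    congr 1
    refine setLIntegral_congr_fun measurableSet_Ioo fun x hx => ?_
    have hx1 : 0 < 1 - x := by linarith [hx.2]
    simp only [F]
    rw [enorm_mul, Complex.enorm_ofReal_eq, Real.enorm_of_nonneg (by positivity)]
  have hC : ∀ v : HalfPlane, cesaroL hα (expVec v) =ᵐ[halfLine]
      fun s => ∫ x in Set.Ioo (0 : ℝ) 1, F (conj (v : ℂ)) s x := fun v => by
    filter_upwards [(isBoundedKernel_cesaro hα).coeFn_op (expVec v), ae_halfLine_pos] with s h1 hs
    rw [cesaroL, h1, ← integral_cesaroKernel hs (fun u => Complex.exp (-conj (v : ℂ) * u))]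
    refine integral_congr_ae ?_
    filter_upwards [coeFn_expVec v] with u hu
    rw [hu]
  -- The inner product conjugates its first slot, which turns `z̄` into `z`.
  have hconj : ∀ c s, conj (∫ x in Set.Ioo (0 : ℝ) 1, F (conj c) s x) =
      ∫ x in Set.Ioo (0 : ℝ) 1, F c s x := fun c s => by
    rw [← integral_conj]
    simp [F, ← Complex.exp_conj]
  have hin : ∀ x ∈ Set.Ioo (0 : ℝ) 1, ∀ y ∈ Set.Ioo (0 : ℝ) 1,
      ∫ s, F z s x * F (conj (w : ℂ)) s y ∂halfLine = (Real.Gamma (α + 1) : ℂ) ^ 2 *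
        ((((1 - x) ^ (α - 1) / Real.Gamma α * ((1 - y) ^ (α - 1) / Real.Gamma α) : ℝ) : ℂ) /
          ((x : ℂ) * (z : ℂ) + (y : ℂ) * conj (w : ℂ))) := fun x hx y hy => by
    have hx0 := hx.1
    have hy0 := hy.1
    have hre : 0 < ((x : ℂ) * (z : ℂ) + (y : ℂ) * conj (w : ℂ)).re := by
      simp only [Complex.add_re, Complex.mul_re, Complex.ofReal_re, Complex.ofReal_im,
        Complex.conj_re, zero_mul, sub_zero]
      positivity
    have hΓ : (Real.Gamma α : ℂ) ≠ 0 := by exact_mod_cast (Real.Gamma_pos_of_pos hα).ne'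
    rw [Real.Gamma_add_one hα.ne', div_eq_mul_one_div, ← integral_exp_neg_mul_Ioi_of_re_pos hre,
      ← integral_const_mul, ← integral_const_mul]
    congr 1; ext s
    have : Complex.exp (-((x : ℂ) * (z : ℂ) + (y : ℂ) * conj (w : ℂ)) * s) =
        Complex.exp (-(z : ℂ) * ((s * x : ℝ) : ℂ)) *
          Complex.exp (-conj (w : ℂ) * ((s * y : ℝ) : ℂ)) := by
      rw [← Complex.exp_add]; push_cast; ring_nf
    rw [this]
    simp only [F]
    push_cast
    field_simp
  rw [L2.inner_def]
  calc ∫ s, ⟪cesaroL hα (expVec z) s, cesaroL hα (expVec w) s⟫_ℂ ∂halfLine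
      = ∫ s, (∫ x in Set.Ioo (0 : ℝ) 1, F z s x) *
          (∫ y in Set.Ioo (0 : ℝ) 1, F (conj (w : ℂ)) s y) ∂halfLine := by
        refine integral_congr_ae ?_
        filter_upwards [hC z, hC w] with s h1 h2
        rw [h1, h2, RCLike.inner_apply, hconj, mul_comm]
    _ = ∫ x in Set.Ioo (0 : ℝ) 1, ∫ y in Set.Ioo (0 : ℝ) 1,
          ∫ s, F z s x * F (conj (w : ℂ)) s y ∂halfLine :=
        integral_integral_mul_integral (hFm _) (hFm _) (lintegral_mul_lt_top_of_sq
          (hFm _).enorm.lintegral_prod_right'.aemeasurable (hF2 _ hz)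
          (hF2 _ (by simpa using hw))).ne
    _ = ∫ x in Set.Ioo (0 : ℝ) 1, ∫ y in Set.Ioo (0 : ℝ) 1, (Real.Gamma (α + 1) : ℂ) ^ 2 *
        ((((1 - x) ^ (α - 1) / Real.Gamma α * ((1 - y) ^ (α - 1) / Real.Gamma α) : ℝ) : ℂ) /
          ((x : ℂ) * (z : ℂ) + (y : ℂ) * conj (w : ℂ))) :=
        setIntegral_congr_fun measurableSet_Ioo fun x hx =>
          setIntegral_congr_fun measurableSet_Ioo fun y hy => hin x hx y hy
    _ = _ := by
        simp only [kernelK, integral_const_mul, intervalIntegral.integral_of_le zero_le_one,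
          integral_Ioc_eq_integral_Ioo]

/-- The arguments swap because `⟪·,·⟫_ℂ` is linear in its second slot and `rangeInner` in its first.
-/
theorem rangeInner_apply {T : L2 → L2} (hT : Function.Injective T) (a b : L2) :
    rangeInner α T (T a) (T b) = (Real.Gamma (α + 1) : ℂ) ^ 2 * ⟪b, a⟫_ℂ := by
  rw [rangeInner, Function.leftInverse_invFun hT, Function.leftInverse_invFun hT, L2.inner_def]
  simp only [RCLike.inner_apply]

theorem rangeNorm_apply {T : L2 → L2} (hT : Function.Injective T) (a : L2) :
    rangeNorm α T (T a) = Real.Gamma (α + 1) * ‖a‖ := by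
  rw [rangeNorm, Function.leftInverse_invFun hT]

theorem laplaceInner_apply {T : L2 → L2} (hT : Function.Injective T) (a b : L2) :
    laplaceInner α T (laplace (T a)) (laplace (T b)) = (Real.Gamma (α + 1) : ℂ) ^ 2 * ⟪b, a⟫_ℂ := by
  rw [laplaceInner, Function.leftInverse_invFun laplace_injective,
    Function.leftInverse_invFun laplace_injective, rangeInner_apply hT]

/-- With `B` adjoint to `A`, `ℒ(A a)(w) = ⟪e_w, A a⟫ = ⟪B e_w, a⟫`, so evaluation at `w` is
represented by `A (c⁻¹ B e_w)`; `c⁻¹` offsets the `Γ(α+1)²` of the transferred inner product. -/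
theorem isReproducingKernel_iff (hα : 0 < α) {A B : L2 →L[ℂ] L2}
    (hadj : ∀ f g, ⟪A f, g⟫_ℂ = ⟪f, B g⟫_ℂ) (hA : Function.Injective A)
    (hK : ∀ z w, ⟪B (expVec z), B (expVec w)⟫_ℂ = (Real.Gamma (α + 1) : ℂ) ^ 2 * kernelK α z w)
    (R : HalfPlane → HalfPlane → ℂ) :
    IsReproducingKernel (laplaceImage A) (laplaceInner α A) R ↔ R = kernelK α := by
  set c : ℂ := (Real.Gamma (α + 1) : ℂ) ^ 2
  have hc : c ≠ 0 := by
    have := (Real.Gamma_pos_of_pos (add_pos hα one_pos)).ne'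
    exact pow_ne_zero 2 (by exact_mod_cast this)
  have hadj' : ∀ f g, ⟪f, A g⟫_ℂ = ⟪B f, g⟫_ℂ := fun f g => by
    rw [← inner_conj_symm, hadj, inner_conj_symm]
  have hconj : conj c = c := by simp [c]
  have hkey : ∀ w, (fun z => kernelK α z w) = laplace (A (c⁻¹ • B (expVec w))) := fun w => by
    ext z
    rw [laplace_eq_inner, hadj', inner_smul_right, hK, inv_mul_cancel_left₀ hc]
  have hrep : ∀ w a, laplaceInner α A (laplace (A a)) (fun z => kernelK α z w) =
      laplace (A a) w := fun w a => by
    rw [hkey, laplaceInner_apply hA, inner_smul_left, map_inv₀, hconj, mul_inv_cancel_left₀ hc,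
      laplace_eq_inner, hadj']
  constructor
  · intro hR
    ext z w
    obtain ⟨-, ⟨r, rfl⟩, hr⟩ := hR.mem w
    -- Uniqueness: two representers of the same evaluation pair equally with every `a`.
    have h : r = c⁻¹ • B (expVec w) := ext_inner_right ℂ fun a => by
      have h1 := hR.reproducing w (laplace (A a)) ⟨A a, ⟨a, rfl⟩, rfl⟩
      rw [← hrep w a, ← hr, hkey, laplaceInner_apply hA, laplaceInner_apply hA] at h1
      exact mul_left_cancel₀ hc h1
    exact (congrFun hr z).symm.trans (by rw [h, ← hkey])
  · rintro rfl
    refine ⟨fun w => ⟨_, ⟨c⁻¹ • B (expVec w), rfl⟩, (hkey w).symm⟩, ?_⟩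
    rintro w _ ⟨_, ⟨a, rfl⟩, rfl⟩
    exact hrep w a

/-! ### Fractional derivatives -/

/-- As `Γ(α+1) = α Γ(α)`, the Riemann-Liouville integral of `u` is `x^α 𝒞_α u / Γ(α+1)`. -/
theorem isRLDeriv_iff (hα : 0 < α) (f : L2) (u : ℝ → ℂ) :
    IsRLDeriv α (fun t => t ^ α • f t) u ↔ ∃ h : MemLp u 2 halfLine,
      (Real.Gamma (α + 1) : ℂ) • f = cesaro α (h.toLp u) := by
  rw [IsRLDeriv, ← exists_prop]
  refine exists_congr fun h => ?_
  have hΓ : (Real.Gamma α : ℂ) ≠ 0 := by exact_mod_cast (Real.Gamma_pos_of_pos hα).ne'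
  have hα' : (α : ℂ) ≠ 0 := by exact_mod_cast hα.ne'
  have hpt : ∀ᵐ x ∂halfLine, (x ^ α • f x =
      ∫ y in Set.Ioo 0 x, ((x - y) ^ (α - 1) / Real.Gamma α) • u y) ↔
      ((Real.Gamma (α + 1) : ℂ) • f) x = cesaro α (h.toLp u) x := by
    filter_upwards [Lp.coeFn_smul (Real.Gamma (α + 1) : ℂ) f, coeFn_cesaro hα (h.toLp u),
      ae_halfLine_pos] with x h1 h2 hx
    have hxα : ((x ^ α : ℝ) : ℂ) ≠ 0 := by exact_mod_cast (Real.rpow_pos_of_pos hx α).ne'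
    have h3 : cesaroFun α (h.toLp u) x = cesaroFun α u x := by
      rw [cesaroFun_eq, cesaroFun_eq]
      refine integral_congr_ae ?_
      filter_upwards [h.coeFn_toLp] with y hy
      rw [hy]
    have h4 : ∫ y in Set.Ioo 0 x, ((x - y) ^ (α - 1) / Real.Gamma α) • u y =
        (Real.Gamma α : ℂ)⁻¹ * ∫ y in Set.Ioo 0 x, (x - y) ^ (α - 1) • u y := by
      rw [← integral_const_mul]
      congr 1; ext y
      rw [Complex.real_smul, Complex.real_smul]; push_cast; ring
    rw [h1, h2, h3, h4, Pi.smul_apply, cesaroFun, Real.Gamma_add_one hα.ne', Complex.real_smul,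
      Complex.real_smul, smul_eq_mul]
    push_cast
    generalize ∫ y in Set.Ioo 0 x, (x - y) ^ (α - 1) • u y = I
    rw [inv_mul_eq_div, eq_div_iff hΓ, div_mul_eq_mul_div, eq_div_iff hxα,
      ← mul_right_inj' hα']
    constructor <;> intro h <;> linear_combination h
  constructor
  · intro H
    refine Lp.ext ?_
    filter_upwards [H, hpt] with x hx hp using hp.1 hx
  · intro H
    filter_upwards [hpt] with x hp using hp.2 (by rw [H])

/-- Here the weight `s^α` cancels the denominator in `𝒞*_α`, so the Weyl integral of `v` is
`𝒞*_α(t^α v) / Γ(α+1)`. -/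
theorem isWeylDeriv_iff (hα : 0 < α) (f : L2) (v : ℝ → ℂ) :
    IsWeylDeriv α f v ↔ ∃ h : MemLp (fun t => t ^ α • v t) 2 halfLine,
      (Real.Gamma (α + 1) : ℂ) • f = cesaroStar α (h.toLp _) := by
  rw [IsWeylDeriv, ← exists_prop]
  refine exists_congr fun h => ?_
  have hΓ : (Real.Gamma α : ℂ) ≠ 0 := by exact_mod_cast (Real.Gamma_pos_of_pos hα).ne'
  have hα' : (α : ℂ) ≠ 0 := by exact_mod_cast hα.ne'
  have hpt : ∀ᵐ x ∂halfLine, (f x =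
      ∫ s in Set.Ioi x, ((s - x) ^ (α - 1) / Real.Gamma α) • v s) ↔
      ((Real.Gamma (α + 1) : ℂ) • f) x = cesaroStar α (h.toLp _) x := by
    filter_upwards [Lp.coeFn_smul (Real.Gamma (α + 1) : ℂ) f, coeFn_cesaroStar hα (h.toLp _),
      ae_halfLine_pos] with x h1 h2 hx
    have h3 : cesaroStarFun α (h.toLp _) x = cesaroStarFun α (fun t => t ^ α • v t) x := by
      rw [cesaroStarFun_eq _ hx.le, cesaroStarFun_eq _ hx.le]
      refine integral_congr_ae ?_
      filter_upwards [h.coeFn_toLp] with y hy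
      rw [hy]
    have h4 : ∫ s in Set.Ioi x, ((s - x) ^ (α - 1) / Real.Gamma α) • v s =
        (Real.Gamma α : ℂ)⁻¹ *
          ∫ s in Set.Ioi x, ((s - x) ^ (α - 1) / s ^ α) • (s ^ α • v s) := by
      rw [← integral_const_mul]
      refine setIntegral_congr_fun measurableSet_Ioi fun s hs => ?_
      have hs0 : 0 < s := hx.trans hs
      have := (Real.rpow_pos_of_pos hs0 α).ne'
      rw [smul_smul, div_mul_cancel₀ _ this, Complex.real_smul, Complex.real_smul]
      push_cast; ring
    rw [h1, h2, h3, h4, Pi.smul_apply, cesaroStarFun, Real.Gamma_add_one hα.ne', Complex.real_smul,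
      smul_eq_mul]
    push_cast
    generalize ∫ s in Set.Ioi x, ((s - x) ^ (α - 1) / s ^ α) • (s ^ α • v s) = I
    rw [inv_mul_eq_div, eq_div_iff hΓ, ← mul_right_inj' hα']
    constructor <;> intro h <;> linear_combination h
  constructor
  · intro H
    refine Lp.ext ?_
    filter_upwards [H, hpt] with x hx hp using hp.1 hx
  · intro H
    filter_upwards [hpt] with x hp using hp.2 (by rw [H])

/-- If `Γ(α + 1) f = T g` for an injective linear operator `T`, then `‖g‖` is the norm of `f` in
the range of `T`. -/
theorem ofReal_rangeNorm_of_smul_eq (hα : 0 < α) {A : L2 →L[ℂ] L2} (hA : Function.Injective A)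
    {f : L2} {g : ℝ → ℂ} (hg : MemLp g 2 halfLine)
    (h : (Real.Gamma (α + 1) : ℂ) • f = A (hg.toLp g)) :
    eLpNorm g 2 halfLine = ENNReal.ofReal (rangeNorm α A f) := by
  have hΓ := Real.Gamma_pos_of_pos (add_pos hα one_pos)
  have hΓ' : (Real.Gamma (α + 1) : ℂ) ≠ 0 := by exact_mod_cast hΓ.ne'
  have hf : f = A ((Real.Gamma (α + 1) : ℂ)⁻¹ • hg.toLp g) := by
    rw [map_smul, ← h, inv_smul_smul₀ hΓ']
  rw [hf, rangeNorm_apply hA, norm_smul, norm_inv, Complex.norm_real, Real.norm_of_nonneg hΓ.le,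
    mul_inv_cancel_left₀ hΓ.ne', Lp.norm_toLp, ENNReal.ofReal_toReal hg.eLpNorm_ne_top]

theorem ae_eq_of_rpow_smul_ae_eq {v v' : ℝ → ℂ}
    (h : (fun t => t ^ α • v t) =ᵐ[halfLine] fun t => t ^ α • v' t) : v =ᵐ[halfLine] v' := by
  filter_upwards [h, ae_halfLine_pos] with t ht h0
  exact smul_right_injective _ (Real.rpow_pos_of_pos h0 α).ne' ht

end CesaroHardy

/-! ### Assembly of the three statements -/

theorem mainTheorem5 (α : ℝ) (hα : 0 < α) :
    -- the two integral formulas define injective bounded linear operators on `L₂(ℝ⁺)`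
    (∀ f : L2,
      (∀ᵐ s ∂halfLine, IntegrableOn (fun u => (s - u) ^ (α - 1) • f u) (Set.Ioo 0 s)) ∧
      (∀ᵐ s ∂halfLine, IntegrableOn (fun u => ((u - s) ^ (α - 1) / u ^ α) • f u) (Set.Ioi s)) ∧
      MemLp (cesaroFun α f) 2 halfLine ∧ MemLp (cesaroStarFun α f) 2 halfLine) ∧
    (IsBoundedLinearMap ℂ (cesaro α) ∧ Function.Injective (cesaro α)) ∧
    (IsBoundedLinearMap ℂ (cesaroStar α) ∧ Function.Injective (cesaroStar α)) ∧
    -- the range spaces coincide, as sets and as Hilbert spaces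
    cesaroRange α = lebesgueSobolev α ∧
    (∀ f ∈ cesaroRange α, ∀ g ∈ cesaroRange α,
      rangeInner α (cesaro α) f g = rangeInner α (cesaroStar α) f g) ∧
    (∀ f ∈ cesaroRange α, rangeNorm α (cesaro α) f = rangeNorm α (cesaroStar α) f) ∧
    -- the Laplace images have one and the same reproducing kernel
    Function.Injective laplace ∧
    (∀ R : HalfPlane → HalfPlane → ℂ,
      IsReproducingKernel (laplaceImage (cesaro α)) (laplaceInner α (cesaro α)) R ↔
        R = kernelK α) ∧
    (∀ Q : HalfPlane → HalfPlane → ℂ,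
      IsReproducingKernel (laplaceImage (cesaroStar α)) (laplaceInner α (cesaroStar α)) Q ↔
        Q = kernelK α) ∧
    -- on the common space both fractional derivatives exist, are unique, and give equal norms
    (∀ f : L2,
      (f ∈ cesaroRange α ↔ ∃ u : ℝ → ℂ, IsRLDeriv α (fun t => t ^ α • f t) u) ∧
      (f ∈ lebesgueSobolev α ↔ ∃ v : ℝ → ℂ, IsWeylDeriv α f v) ∧
      (∀ u u' : ℝ → ℂ, IsRLDeriv α (fun t => t ^ α • f t) u →
        IsRLDeriv α (fun t => t ^ α • f t) u' → u =ᵐ[halfLine] u') ∧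
      (∀ v v' : ℝ → ℂ, IsWeylDeriv α f v → IsWeylDeriv α f v' → v =ᵐ[halfLine] v')) ∧
    (∀ f ∈ cesaroRange α, ∀ u v : ℝ → ℂ,
      IsRLDeriv α (fun t => t ^ α • f t) u → IsWeylDeriv α f v →
        eLpNorm u 2 halfLine = ENNReal.ofReal (rangeNorm α (cesaro α) f) ∧
        eLpNorm (fun t => t ^ α • v t) 2 halfLine =
          ENNReal.ofReal (rangeNorm α (cesaroStar α) f) ∧
        eLpNorm u 2 halfLine = eLpNorm (fun t => t ^ α • v t) 2 halfLine) := by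
  have hCi := cesaroL_injective hα
  have hSi := cesaroStarL_injective hα
  have hadj := inner_cesaroL_left hα
  have hadj' : ∀ f g, inner ℂ (cesaroStarL hα f) g = inner ℂ f (cesaroL hα g) := fun f g => by
    rw [← inner_conj_symm, ← hadj, inner_conj_symm]
  -- The preimages of one `f` under `𝒞` and `𝒞*` differ by the unitary `V`; equality of ranges,
  -- inner products and norms all follow from this.
  obtain ⟨V, hV⟩ := exists_linearIsometryEquiv_of_normal hadj (inner_cesaroL_cesaroL hα) hCi
  have hV' : ∀ x, cesaroL hα x = cesaroStarL hα (V.symm x) := fun x => by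
    rw [hV, V.apply_symm_apply]
  have hrange : Set.range (cesaroL hα) = Set.range (cesaroStarL hα) := by
    ext f
    exact ⟨fun ⟨x, hx⟩ => ⟨V.symm x, by rw [← hV', hx]⟩, fun ⟨x, hx⟩ => ⟨V x, by rw [← hV, hx]⟩⟩
  have hΓ : (Real.Gamma (α + 1) : ℂ) ≠ 0 := by
    exact_mod_cast (Real.Gamma_pos_of_pos (add_pos hα one_pos)).ne'
  have hmem : ∀ (A : L2 →L[ℂ] L2) (f : L2),
      f ∈ Set.range A ↔ ∃ a, (Real.Gamma (α + 1) : ℂ) • f = A a := fun A f =>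
    ⟨fun ⟨a, ha⟩ => ⟨(Real.Gamma (α + 1) : ℂ) • a, by rw [map_smul, ha]⟩,
      fun ⟨a, ha⟩ => ⟨(Real.Gamma (α + 1) : ℂ)⁻¹ • a, by rw [map_smul, ← ha, inv_smul_smul₀ hΓ]⟩⟩
  have hRL := isRLDeriv_iff hα
  have hW := isWeylDeriv_iff hα
  simp only [cesaroRange, lebesgueSobolev]
  simp only [← coe_cesaroL hα, ← coe_cesaroStarL hα] at hRL hW ⊢
  refine ⟨fun f => ⟨ae_integrableOn_cesaro hα f, ae_integrableOn_cesaroStar hα f,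
      memLp_cesaroFun hα f, memLp_cesaroStarFun hα f⟩,
    ⟨(cesaroL hα).isBoundedLinearMap, hCi⟩, ⟨(cesaroStarL hα).isBoundedLinearMap, hSi⟩,
    hrange, ?_, ?_, laplace_injective,
    -- For the range of `𝒞` the kernel involves `𝒞*`; normality replaces it by the form already
    -- computed for `𝒞`.
    isReproducingKernel_iff hα hadj hCi fun z w => by
      rw [← inner_cesaroL_cesaroL, inner_cesaroL_expVec],
    isReproducingKernel_iff hα hadj' hSi (inner_cesaroL_expVec hα),
    fun f => ⟨?_, ?_, fun u u' hu hu' => ?_, fun v v' hv hv' => ?_⟩, ?_⟩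
  · rintro _ ⟨a, rfl⟩ _ ⟨b, rfl⟩
    rw [rangeInner_apply hCi, hV', hV', rangeInner_apply hSi, V.symm.inner_map_map]
  · rintro _ ⟨a, rfl⟩
    rw [rangeNorm_apply hCi, hV', rangeNorm_apply hSi, V.symm.norm_map]
  · rw [hmem]
    constructor
    · rintro ⟨a, ha⟩
      exact ⟨a, (hRL f a).2 ⟨Lp.memLp a, by rw [Lp.toLp_coeFn, ha]⟩⟩
    · rintro ⟨u, hu⟩
      obtain ⟨h, hf⟩ := (hRL f u).1 hu
      exact ⟨_, hf⟩
  · rw [hmem]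
    constructor
    · rintro ⟨b, hb⟩
      have hae : (fun t : ℝ => t ^ α • ((t ^ α)⁻¹ • b t)) =ᵐ[halfLine] b := by
        filter_upwards [ae_halfLine_pos] with t ht
        rw [smul_inv_smul₀ (Real.rpow_pos_of_pos ht α).ne']
      -- The Weyl derivative is forced to be `t^{-α} b`, where `Γ(α+1) f = 𝒞* b`.
      refine ⟨fun t => (t ^ α)⁻¹ • b t, (hW f _).2 ⟨(memLp_congr_ae hae).2 (Lp.memLp b), ?_⟩⟩
      rw [hb, ← MemLp.toLp_congr (Lp.memLp b) ((memLp_congr_ae hae).2 (Lp.memLp b)) hae.symm,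
        Lp.toLp_coeFn]
    · rintro ⟨v, hv⟩
      obtain ⟨h, hf⟩ := (hW f v).1 hv
      exact ⟨_, hf⟩
  · obtain ⟨h, hf⟩ := (hRL f u).1 hu
    obtain ⟨h', hf'⟩ := (hRL f u').1 hu'
    exact (MemLp.toLp_eq_toLp_iff h h').1 (hCi (hf.symm.trans hf'))
  · obtain ⟨h, hf⟩ := (hW f v).1 hv
    obtain ⟨h', hf'⟩ := (hW f v').1 hv'
    exact ae_eq_of_rpow_smul_ae_eq ((MemLp.toLp_eq_toLp_iff h h').1 (hSi (hf.symm.trans hf')))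
  · rintro f ⟨a, rfl⟩ u v hu hv
    obtain ⟨h, hf⟩ := (hRL _ u).1 hu
    obtain ⟨h', hf'⟩ := (hW _ v).1 hv
    have h1 := ofReal_rangeNorm_of_smul_eq hα hCi h hf
    have h2 := ofReal_rangeNorm_of_smul_eq hα hSi h' hf'
    refine ⟨h1, h2, ?_⟩
    rw [h1, h2, rangeNorm_apply hCi, hV', rangeNorm_apply hSi, V.symm.norm_map]
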